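/- Let $\alpha\in(0,1)$ and let $\psi=(\psi(t),\,t\ge 0)$ be the tempered $\alpha$-stable subordinator, i.e. the subordinator (nonnegative process with $\psi(0)=0$ a.s., independent stationary increments and a.s. nondecreasing right-continuous paths) determined by $$\mathbb E\, e^{-u\psi(1)}=\exp\{1-(1+u)^{\alpha}\},\qquad u\ge 0 .$$ Terminology. Paths live in $\mathbb R_+^{[0,\infty)}$ with its cylindrical $\sigma$-algebra, $\overset{d}{=}$ is equality of laws there, and $x1_{[s,\infty)}$ denotes the path $t\mapsto x1_{\{t\ge s\}}$. The Lévy measure of a nonnegative infinitely divisible process $\xi$ without drift is the unique measure $\nu$ on $\mathbb R_+^{[0,\infty)}$ such that $\mathbb E\exp\{-\sum_i c_i\xi(t_i)\}=\exp\{-\int(1-e^{-\sum_i c_iy(t_i)})\,\nu(dy)\}$ for all finite families $t_i\ge0$, $c_i\ge 0$; $\int (y(t)\wedge 1)\,\nu(dy)<\infty$ for all $t$; and $\nu(A)=\nu_*(A\setminus\{0\})$ for all measurable $A$, where $\nu_*$ is the inner measure; $\nu(F)$ denotes $\int F\,d\nu$. For $a>0$, $(\psi\mid\psi(a)=0)$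 denotes the limit, in finite-dimensional distributions, of $\psi$ conditioned on $\{\psi(a)\le\varepsilon\}$ as $\varepsilon\downarrow0$, and $\mathcal L^{(a)}$ denotes a nonnegative infinitely divisible process such that $$\psi\overset{d}{=}(\psi\mid\psi(a)=0)+\mathcal L^{(a)},$$ the two terms on the right being independent and infinitely divisible. (a4) For every $a>0$, $\mathbb E\psi(a)=\alpha a$. If $G\sim\mathrm{Gamma}(1-\alpha,1)$ and $U$ is uniform on $[0,1]$, with $G$, $U$ and $\psi$ independent, then $r^{(a)}(t):=G1_{[aU,\infty)}(t)$ satisfies $$(\psi(t)+G1_{[aU,\infty)}(t),\ t\ge0)\ \overset{d}{=}\ (\psi(t),\ t\ge0)\ \text{ under }\ \mathbb E\Big[\frac{\psi(a)}{\alpha a};\ \cdot\ \Big].$$ (b4) $\psi$ has a unique Lévy measure $\nu$. If $G$ and $U$ have the laws in (a4), $Y$ is standard exponential, and $G,U,Y$ are independent, then $$\nu(F)=\alpha\,\mathbb E\big[G^{-1}Ye^{UY}F(G1_{[UY,\infty)})\big]$$ for every measurable $F:\mathbb R_+^{[0,\infty)}\to[0,\infty]$; that is, $\nu$ is the law of the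 process $G1_{[UY,\infty)}$ under the measure $\alpha\,G^{-1}Ye^{UY}\,d\mathbb P$. (c4) For every $a>0$, the processes $(\psi\mid\psi(a)=0)$ and $\mathcal L^{(a)}$ exist, are unique in law, and $$(\psi\mid\psi(a)=0)\overset{d}{=}(\psi(t\vee a)-\psi(a),\ t\ge0),\qquad \mathcal L^{(a)}\overset{d}{=}(\psi(t\wedge a),\ t\ge0).$$ Their (unique) Lévy measures $\nu_a$ and $\tilde\nu_a$ are given, for every measurable $F:\mathbb R_+^{[0,\infty)}\to[0,\infty]$, by $$\nu_a(F)=\frac1{|\Gamma(-\alpha)|}\int_a^\infty\!\!\int_0^\infty F(x1_{[s,\infty)})\,x^{-\alpha-1}e^{-x}\,dx\,ds,\qquad \tilde\nu_a(F)=\frac1{|\Gamma(-\alpha)|}\int_0^a\!\!\int_0^\infty F(x1_{[s,\infty)})\,x^{-\alpha-1}e^{-x}\,dx\,ds .$$ -/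

import Mathlib

open MeasureTheory ProbabilityTheory Filter Topology Set
open scoped NNReal ENNReal

/-- Nonnegative functions of time `t ∈ [0, ∞)`; the product (cylindrical) `σ`-algebra is the
one carried by function types. -/
abbrev TimePath : Type := ℝ≥0 → ℝ≥0

/-- The path `x 1_{[s, ∞)}`. -/
noncomputable def stepPath (x s : ℝ≥0) : TimePath :=
  (Ici s).indicator (fun _ => x)

/-- The law of a nonnegative process on path space. -/
noncomputable def pathLaw {Ω : Type*} [MeasurableSpace Ω] (P : Measure Ω)
    (X : ℝ≥0 → Ω → ℝ≥0) : Measure TimePath :=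
  P.map (fun ω t => X t ω)

/-- A subordinator: a process started at `0` with independent and stationary increments whose
paths are almost surely nondecreasing and right-continuous (left limits are then automatic). -/
structure IsSubordinator {Ω : Type*} [MeasurableSpace Ω] (P : Measure Ω)
    (ψ : ℝ≥0 → Ω → ℝ≥0) : Prop where
  measurable : ∀ t, Measurable (ψ t)
  zero : ∀ᵐ ω ∂P, ψ 0 ω = 0
  indep : HasIndepIncrements (fun t ω => (ψ t ω : ℝ)) P
  stationary : ∀ s t, IdentDistrib (fun ω => (ψ (s + t) ω : ℝ) - ψ s ω)
    (fun ω => (ψ t ω : ℝ)) P P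
  paths : ∀ᵐ ω ∂P, Monotone (fun t => ψ t ω) ∧
    ∀ t, ContinuousWithinAt (fun t => ψ t ω) (Ici t) t

/-- The tempered `α`-stable subordinator normalized by
`E exp (-u ψ(1)) = exp (1 - (1 + u) ^ α)`. -/
structure IsTemperedStableSubordinator {Ω : Type*} [MeasurableSpace Ω] (P : Measure Ω)
    (α : ℝ) (ψ : ℝ≥0 → Ω → ℝ≥0) : Prop extends IsSubordinator P ψ where
  laplace : ∀ u : ℝ, 0 ≤ u →
    ∫ ω, Real.exp (-u * ψ 1 ω) ∂P = Real.exp (1 - (1 + u) ^ α)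

/-- `ν` is the Lévy measure of a nonnegative infinitely divisible driftless process with law
`μ`. The last field says `ν A = ν_* (A \ {0})`, where `ν_*` is the inner measure. -/
structure IsLevyMeasure (μ ν : Measure TimePath) : Prop where
  laplace : ∀ (I : Finset ℝ≥0) (c : ℝ≥0 → ℝ≥0),
    ∫ y, Real.exp (-∑ t ∈ I, (c t : ℝ) * y t) ∂μ =
      Real.exp (-∫ y, (1 - Real.exp (-∑ t ∈ I, (c t : ℝ) * y t)) ∂ν)
  lintegral_lt_top : ∀ t, ∫⁻ y, (min (y t) 1 : ℝ≥0) ∂ν < ∞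
  inner : ∀ A : Set TimePath, MeasurableSet A →
    ν A = ⨆ (B : Set TimePath) (_ : MeasurableSet B) (_ : B ⊆ A \ {0}), ν B

/-- A probability law on path space is infinitely divisible if each finite-dimensional marginal
is, for every `n ≥ 1`, the law of a sum of `n` independent identically distributed vectors. -/
def IsInfDivLaw (μ : Measure TimePath) : Prop :=
  IsProbabilityMeasure μ ∧ ∀ (I : Finset ℝ≥0) (n : ℕ), 1 ≤ n →
    ∃ ρ : Measure (I → ℝ), IsProbabilityMeasure ρ ∧
      μ.map (fun y (t : I) => (y t : ℝ)) =
        (Measure.pi (fun _ : Fin n => ρ)).map (fun x => ∑ k, x k)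

/-- `κ` is the law of `(ψ | ψ(a) = 0)`, where `ψ` has law `μ`: the limit, in the sense of
finite-dimensional distributions, of the law of `ψ` given `ψ(a) ≤ ε` as `ε ↓ 0`. (If
`ψ(a) = 0` has positive probability this is the elementary conditional law.) -/
def IsCondLawAtZero (μ : Measure TimePath) (a : ℝ≥0) (κ : Measure TimePath) : Prop :=
  IsProbabilityMeasure κ ∧ ∀ (I : Finset ℝ≥0) (f : BoundedContinuousFunction (I → ℝ≥0) ℝ),
    Tendsto (fun ε : ℝ≥0 => ∫ y, f (I.restrict y) ∂(μ[|{y : TimePath | y a ≤ ε}]))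
      (𝓝[>] 0) (𝓝 (∫ y, f (I.restrict y) ∂κ))

/-- `η` is the law of the component `𝓛^{(a)}` in `ψ = (ψ | ψ(a) = 0) + 𝓛^{(a)}` (in law), a sum
of two independent infinitely divisible nonnegative processes, where `ψ` has law `μ`. -/
def IsComplementLaw (μ : Measure TimePath) (a : ℝ≥0) (η : Measure TimePath) : Prop :=
  IsInfDivLaw η ∧ ∃ κ : Measure TimePath, IsCondLawAtZero μ a κ ∧ IsInfDivLaw κ ∧
    (κ.prod η).map (fun p => p.1 + p.2) = μ

/-- `|Γ(-α)|⁻¹ ∫_S ∫_0^∞ F(x 1_{[s, ∞)}) x^{-α-1} e^{-x} dx ds`. -/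
noncomputable def temperedJumpIntegral (α : ℝ) (S : Set ℝ) (F : TimePath → ℝ≥0∞) : ℝ≥0∞ :=
  ENNReal.ofReal (1 / |Real.Gamma (-α)|) *
    ∫⁻ s in S, ∫⁻ x in Ioi (0 : ℝ),
      F (stepPath x.toNNReal s.toNNReal) * ENNReal.ofReal (x ^ (-α - 1) * Real.exp (-x))

/-!
A subordinator with Laplace exponent `φ` satisfies
`E exp (-∑ c(t) ψ(t)) = exp (-∫ φ (∑_{t ≥ s} c(t)) ds)`, and laws as well as Lévy measures on path
space are determined by such Laplace functionals. Restricting the integral to `s ≤ a` and to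
`s > a` splits `ψ` into its independent past and future at time `a`; conditioning on `ψ(a) ≤ ε`
concerns only the past, which disappears as `ε → 0`.

For the tempered stable subordinator the jump intensity `π` satisfies
`x π(dx) = α Gamma(1 - α, 1)(dx)`. Differentiating the Lévy–Khintchine formula in the weight of the
time `a` shows that size-biasing by `ψ(a)` inserts one independent jump drawn from `y(a) ν(dy)`;
this jump has size `G` and time `aU`. In the formula for `ν` itself, the factor `Y e^{UY}`
turns the law of `UY` into Lebesgue measure on `(0, ∞)`.
-/

section LaplaceFunctional

variable {ι κ : Type*}

/-- The exponential functional `y ↦ exp (-∑ i, c(i) y(i))` with finitely supported weights `c`.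
Its integral is the Laplace functional of a measure on paths. -/
noncomputable def pathExp (c : ι →₀ ℝ≥0) (y : ι → ℝ≥0) : ℝ :=
  Real.exp (-(Finsupp.linearCombination ℝ≥0 y c : ℝ≥0))

lemma pathExp_zero_weight (y : ι → ℝ≥0) : pathExp 0 y = 1 := by
  simp [pathExp]

lemma pathExp_add_weight (c d : ι →₀ ℝ≥0) (y : ι → ℝ≥0) :
    pathExp (c + d) y = pathExp c y * pathExp d y := by
  simp only [pathExp, map_add, NNReal.coe_add, neg_add, Real.exp_add]

lemma pathExp_single (i : ι) (u : ℝ≥0) (y : ι → ℝ≥0) :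
    pathExp (Finsupp.single i u) y = Real.exp (-(u * y i : ℝ)) := by
  simp [pathExp]

lemma pathExp_sum_single (I : Finset ι) (c : ι → ℝ≥0) (y : ι → ℝ≥0) :
    pathExp (∑ i ∈ I, Finsupp.single i (c i)) y = Real.exp (-∑ i ∈ I, (c i : ℝ) * y i) := by
  simp [pathExp, NNReal.coe_sum]

lemma pathExp_mapDomain (f : ι → κ) (c : ι →₀ ℝ≥0) (y : κ → ℝ≥0) :
    pathExp (c.mapDomain f) y = pathExp c (y ∘ f) := by
  rw [pathExp, Finsupp.linearCombination_mapDomain, pathExp]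

lemma pathExp_add (c : ι →₀ ℝ≥0) (y z : ι → ℝ≥0) :
    pathExp c (y + z) = pathExp c y * pathExp c z := by
  simp only [pathExp, Finsupp.linearCombination_apply, Pi.add_apply, smul_add, Finsupp.sum_add,
    NNReal.coe_add, neg_add, Real.exp_add]

lemma pathExp_pos (c : ι →₀ ℝ≥0) (y : ι → ℝ≥0) : 0 < pathExp c y :=
  Real.exp_pos _

lemma pathExp_le_one (c : ι →₀ ℝ≥0) (y : ι → ℝ≥0) : pathExp c y ≤ 1 :=
  Real.exp_le_one_iff.2 (neg_nonpos.2 (NNReal.coe_nonneg _))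

@[fun_prop]
lemma continuous_pathExp (c : ι →₀ ℝ≥0) : Continuous (pathExp c) := by
  unfold pathExp
  simp only [Finsupp.linearCombination_apply, Finsupp.sum]
  fun_prop

@[fun_prop]
lemma measurable_pathExp (c : ι →₀ ℝ≥0) : Measurable (pathExp c) := by
  unfold pathExp
  simp only [Finsupp.linearCombination_apply, Finsupp.sum]
  fun_prop

lemma norm_pathExp_le_one (c : ι →₀ ℝ≥0) (y : ι → ℝ≥0) : ‖pathExp c y‖ ≤ 1 := by
  rw [Real.norm_of_nonneg (pathExp_pos c y).le]
  exact pathExp_le_one c y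

lemma integrable_pathExp (μ : Measure (ι → ℝ≥0)) [IsFiniteMeasure μ] (c : ι →₀ ℝ≥0) :
    Integrable (pathExp c) μ :=
  .of_bound (by fun_prop) 1 (ae_of_all _ (norm_pathExp_le_one c))

lemma integral_pathExp_pos (μ : Measure (ι → ℝ≥0)) [IsProbabilityMeasure μ] (c : ι →₀ ℝ≥0) :
    0 < ∫ y, pathExp c y ∂μ :=
  integral_exp_pos (integrable_pathExp μ c)

open BoundedContinuousFunction

lemma integral_eq_of_mem_span {X : Type*} [TopologicalSpace X] [MeasurableSpace X]
    [OpensMeasurableSpace X] {μ ν : Measure X} [IsFiniteMeasure μ] [IsFiniteMeasure ν]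
    {S : Set (X →ᵇ ℝ)} (hS : ∀ f ∈ S, ∫ x, f x ∂μ = ∫ x, f x ∂ν) {f : X →ᵇ ℝ}
    (hf : f ∈ Submodule.span ℝ S) : ∫ x, f x ∂μ = ∫ x, f x ∂ν := by
  induction hf using Submodule.span_induction with
  | mem f hf => exact hS f hf
  | zero => simp
  | add f g _ _ hf hg =>
    simp only [coe_add, Pi.add_apply, integral_add (f.integrable _) (g.integrable _), hf, hg]
  | smul r f _ hf => simp only [coe_smul, integral_smul, hf]

/-- `pathExp` as a multiplicative family of bounded continuous functions; its range spans the
algebra to which the Stone–Weierstrass theorem is applied. -/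
noncomputable def pathExpHom (ι : Type*) :
    Multiplicative (ι →₀ ℝ≥0) →* ((ι → ℝ≥0) →ᵇ ℝ) where
  toFun c := ofNormedAddCommGroup (pathExp c.toAdd) (by fun_prop) 1 (norm_pathExp_le_one _)
  map_one' := by ext y; exact pathExp_zero_weight y
  map_mul' c d := by ext y; exact pathExp_add_weight c.toAdd d.toAdd y

/-- The real algebra generated by the functionals `pathExp c`. -/
noncomputable def pathExpAlgebra (ι : Type*) : StarSubalgebra ℝ ((ι → ℝ≥0) →ᵇ ℝ) where
  __ := Algebra.adjoin ℝ (MonoidHom.mrange (pathExpHom ι) : Set ((ι → ℝ≥0) →ᵇ ℝ))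
  star_mem' {f} hf := by rwa [show star f = f by ext; simp]

lemma mem_span_of_mem_pathExpAlgebra {f : (ι → ℝ≥0) →ᵇ ℝ} (hf : f ∈ pathExpAlgebra ι) :
    f ∈ Submodule.span ℝ (MonoidHom.mrange (pathExpHom ι) : Set ((ι → ℝ≥0) →ᵇ ℝ)) := by
  have hf' : f ∈ Algebra.adjoin ℝ (MonoidHom.mrange (pathExpHom ι) : Set ((ι → ℝ≥0) →ᵇ ℝ)) := hf
  rwa [← Subalgebra.mem_toSubmodule, Algebra.adjoin_eq_span, Submonoid.closure_eq] at hf'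

theorem ext_of_integral_pathExp_of_finite [Finite ι] {μ ν : Measure (ι → ℝ≥0)}
    [IsFiniteMeasure μ] [IsFiniteMeasure ν]
    (h : ∀ c, ∫ y, pathExp c y ∂μ = ∫ y, pathExp c y ∂ν) : μ = ν := by
  have := Fintype.ofFinite ι
  refine ext_of_forall_mem_subalgebra_integral_eq_of_pseudoEMetric_complete_countable
    (A := pathExpAlgebra ι) (fun x y hxy => ?_) fun f hf =>
      integral_eq_of_mem_span ?_ (mem_span_of_mem_pathExpAlgebra hf)
  · obtain ⟨i, hi⟩ := Function.ne_iff.1 hxy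
    refine ⟨_, ⟨toContinuousMapStarₐ ℝ (pathExpHom ι (.ofAdd (Finsupp.single i 1))),
      ⟨_, Algebra.subset_adjoin ⟨_, rfl⟩, rfl⟩, rfl⟩, ?_⟩
    change pathExp (Finsupp.single i 1) x ≠ pathExp (Finsupp.single i 1) y
    simpa [pathExp_single] using hi
  · rintro _ ⟨c, rfl⟩
    exact h c.toAdd

lemma ext_of_map_restrict {X : ι → Type*} [∀ i, MeasurableSpace (X i)]
    {μ ν : Measure (∀ i, X i)} [IsFiniteMeasure μ]
    (h : ∀ I : Finset ι, μ.map I.restrict = ν.map I.restrict) : μ = ν :=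
  IsProjectiveLimit.unique (P := fun I : Finset ι => μ.map I.restrict) (fun _ => rfl)
    (fun I => (h I).symm)

theorem ext_of_integral_pathExp {μ ν : Measure (ι → ℝ≥0)} [IsFiniteMeasure μ] [IsFiniteMeasure ν]
    (h : ∀ c, ∫ y, pathExp c y ∂μ = ∫ y, pathExp c y ∂ν) : μ = ν := by
  refine ext_of_map_restrict fun I => ext_of_integral_pathExp_of_finite fun c => ?_
  rw [integral_map (by fun_prop) (by fun_prop), integral_map (by fun_prop) (by fun_prop)]
  have hc := h (c.mapDomain Subtype.val)
  simp only [pathExp_mapDomain] at hc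
  exact hc

lemma integral_pathExp_map_add (μ ν : Measure (ι → ℝ≥0)) [SFinite μ] [SFinite ν]
    (c : ι →₀ ℝ≥0) :
    ∫ y, pathExp c y ∂((μ.prod ν).map fun p => p.1 + p.2) =
      (∫ y, pathExp c y ∂μ) * ∫ y, pathExp c y ∂ν := by
  rw [integral_map (by fun_prop) (by fun_prop), ← integral_prod_mul]
  simp only [pathExp_add]

theorem eq_of_map_add_eq {κ η η' : Measure (ι → ℝ≥0)} [IsProbabilityMeasure κ]
    [IsFiniteMeasure η] [IsFiniteMeasure η']
    (h : (κ.prod η).map (fun p => p.1 + p.2) = (κ.prod η').map fun p => p.1 + p.2) : η = η' := by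
  refine ext_of_integral_pathExp fun c => ?_
  have hmul := congrArg (fun ρ => ∫ y, pathExp c y ∂ρ) h
  simp only [integral_pathExp_map_add] at hmul
  exact mul_left_cancel₀ (integral_pathExp_pos κ c).ne' hmul

end LaplaceFunctional

section LevyMeasure

lemma one_sub_exp_neg_mul_le {u x : ℝ} (hu : 0 ≤ u) (hx : 0 ≤ x) :
    1 - Real.exp (-(u * x)) ≤ (u + 1) * min x 1 := by
  rcases le_total x 1 with h | h
  · rw [min_eq_left h]
    nlinarith [Real.add_one_le_exp (-(u * x))]
  · rw [min_eq_right h]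
    nlinarith [Real.exp_pos (-(u * x))]

lemma restrict_eq_of_withDensity_eq {X : Type*} [MeasurableSpace X] {μ ν : Measure X}
    {f : X → ℝ≥0∞} (hf : Measurable f) (hf_top : ∀ x, f x ≠ ∞) {s : Set X} (hs : MeasurableSet s)
    (hf_zero : ∀ x ∈ s, f x ≠ 0) (h : μ.withDensity f = ν.withDensity f) :
    μ.restrict s = ν.restrict s := by
  have recover (ρ : Measure X) :
      ((ρ.withDensity f).restrict s).withDensity (fun x => (f x)⁻¹) = ρ.restrict s := by
    rw [restrict_withDensity hs]
    exact withDensity_inv_same hf (ae_restrict_of_forall_mem hs hf_zero) (ae_of_all _ hf_top)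
  rw [← recover μ, ← recover ν, h]

variable {ι : Type*}

lemma integrable_min_one {ν : Measure (ι → ℝ≥0)} {i : ι}
    (h : ∫⁻ y, (min (y i) 1 : ℝ≥0) ∂ν < ∞) :
    Integrable (fun y : ι → ℝ≥0 => min (y i : ℝ) 1) ν := by
  refine (integrable_toReal_of_lintegral_ne_top (Measurable.aemeasurable (by fun_prop)) h.ne).congr
    (ae_of_all _ fun y => ?_)
  simp only [ENNReal.coe_toReal, NNReal.coe_min, NNReal.coe_one]

lemma integrable_one_sub_pathExp {ν : Measure (ι → ℝ≥0)}
    (h : ∀ i, ∫⁻ y, (min (y i) 1 : ℝ≥0) ∂ν < ∞) (c : ι →₀ ℝ≥0) :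
    Integrable (fun y => 1 - pathExp c y) ν := by
  induction c using Finsupp.induction_linear with
  | zero => simp [pathExp_zero_weight]
  | add c d hc hd =>
    have hprod : Integrable (fun y => pathExp c y * (1 - pathExp d y)) ν :=
      hd.bdd_mul (by fun_prop) (ae_of_all _ (norm_pathExp_le_one c))
    refine (hc.add hprod).congr (ae_of_all _ fun y => ?_)
    simp only [Pi.add_apply, pathExp_add_weight]
    ring
  | single i u =>
    refine ((integrable_min_one (h i)).const_mul (u + 1 : ℝ)).mono' (by fun_prop)
      (ae_of_all _ fun y => ?_)
    rw [Real.norm_of_nonneg (sub_nonneg.2 (pathExp_le_one _ y)), pathExp_single]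
    exact one_sub_exp_neg_mul_le u.2 (y i).2

lemma isFiniteMeasure_withDensity_one_sub_pathExp {ν : Measure (ι → ℝ≥0)}
    (h : ∀ i, ∫⁻ y, (min (y i) 1 : ℝ≥0) ∂ν < ∞) (c : ι →₀ ℝ≥0) :
    IsFiniteMeasure (ν.withDensity fun y => ENNReal.ofReal (1 - pathExp c y)) :=
  isFiniteMeasure_withDensity_ofReal (integrable_one_sub_pathExp h c).2

lemma integral_pathExp_mul_one_sub_pathExp_eq_sub {ν : Measure (ι → ℝ≥0)}
    (h : ∀ i, ∫⁻ y, (min (y i) 1 : ℝ≥0) ∂ν < ∞) (c d : ι →₀ ℝ≥0) :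
    ∫ y, pathExp c y * (1 - pathExp d y) ∂ν =
      ∫ y, (1 - pathExp (c + d) y) ∂ν - ∫ y, (1 - pathExp c y) ∂ν := by
  rw [← integral_sub (integrable_one_sub_pathExp h _) (integrable_one_sub_pathExp h _)]
  simp only [pathExp_add_weight]
  congr with y
  ring

lemma integral_pathExp_withDensity (ν : Measure (ι → ℝ≥0)) (c d : ι →₀ ℝ≥0) :
    ∫ y, pathExp c y ∂(ν.withDensity fun y => ENNReal.ofReal (1 - pathExp d y)) =
      ∫ y, pathExp c y * (1 - pathExp d y) ∂ν := by
  rw [integral_withDensity_eq_integral_toReal_smul (by fun_prop)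
    (ae_of_all _ fun _ => ENNReal.ofReal_lt_top)]
  congr with y
  rw [ENNReal.toReal_ofReal (sub_nonneg.2 (pathExp_le_one d y)), smul_eq_mul, mul_comm]

-- The finite measures `(1 - exp (-y i)) ν(dy)` have the Laplace functional
-- `c ↦ Φ (c + δ_i) - Φ c`, where `Φ` is the Laplace exponent of `ν`.
lemma restrict_coordinate_ne_zero_eq {ν ν' : Measure (ι → ℝ≥0)}
    (hν : ∀ i, ∫⁻ y, (min (y i) 1 : ℝ≥0) ∂ν < ∞) (hν' : ∀ i, ∫⁻ y, (min (y i) 1 : ℝ≥0) ∂ν' < ∞)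
    (h : ∀ c, ∫ y, (1 - pathExp c y) ∂ν = ∫ y, (1 - pathExp c y) ∂ν') (i : ι) :
    ν.restrict {y | y i ≠ 0} = ν'.restrict {y | y i ≠ 0} := by
  have := isFiniteMeasure_withDensity_one_sub_pathExp hν (Finsupp.single i 1)
  have := isFiniteMeasure_withDensity_one_sub_pathExp hν' (Finsupp.single i 1)
  refine restrict_eq_of_withDensity_eq
    (f := fun y => ENNReal.ofReal (1 - pathExp (Finsupp.single i 1) y))
    (by fun_prop) (fun _ => ENNReal.ofReal_ne_top) (by measurability) (fun y hy => ?_)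
    (ext_of_integral_pathExp fun c => ?_)
  · have hpos : 0 < (y i : ℝ) := NNReal.coe_pos.2 (pos_iff_ne_zero.2 hy)
    simpa [pathExp_single] using hpos
  · simp only [integral_pathExp_withDensity, integral_pathExp_mul_one_sub_pathExp_eq_sub hν,
      integral_pathExp_mul_one_sub_pathExp_eq_sub hν', h]

lemma exists_countable_subset_iUnion_coordinate_ne_zero {B : Set (ι → ℝ≥0)}
    (hB : MeasurableSet B) (h0 : 0 ∉ B) :
    ∃ T : Set ι, T.Countable ∧ B ⊆ ⋃ i ∈ T, {y | y i ≠ 0} := by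
  obtain ⟨T, C, hT, rfl⟩ := hB.eq_preimage_restrict_countable
  refine ⟨T, hT, fun y hy => ?_⟩
  by_contra hcon
  simp only [mem_iUnion, mem_ofPred_eq, not_exists, not_not] at hcon
  have hy0 : T.domRestrict y = T.domRestrict (0 : ι → ℝ≥0) := funext fun i => hcon i i.2
  exact h0 (by rwa [mem_preimage, ← hy0])

variable {μ ν ν' : Measure TimePath}

lemma IsLevyMeasure.integral_pathExp (h : IsLevyMeasure μ ν) (c : ℝ≥0 →₀ ℝ≥0) :
    ∫ y, pathExp c y ∂μ = Real.exp (-∫ y, (1 - pathExp c y) ∂ν) := by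
  have hc := h.laplace c.support c
  simp only [← pathExp_sum_single] at hc
  rwa [show ∑ t ∈ c.support, Finsupp.single t (c t) = c from c.sum_single] at hc

theorem IsLevyMeasure.unique (h : IsLevyMeasure μ ν) (h' : IsLevyMeasure μ ν') : ν = ν' := by
  have hexponent (c : ℝ≥0 →₀ ℝ≥0) : ∫ y, (1 - pathExp c y) ∂ν = ∫ y, (1 - pathExp c y) ∂ν' :=
    neg_injective <| Real.exp_injective <|
      (h.integral_pathExp c).symm.trans (h'.integral_pathExp c)
  ext A hA
  rw [h.inner A hA, h'.inner A hA]
  refine iSup_congr fun B => iSup_congr fun hB => iSup_congr fun hBA => ?_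
  obtain ⟨T, hT, hsub⟩ :=
    exists_countable_subset_iUnion_coordinate_ne_zero hB fun h0 => (hBA h0).2 rfl
  have hrestrict := (Measure.restrict_biUnion_congr hT).2 fun t _ =>
    restrict_coordinate_ne_zero_eq h.lintegral_lt_top h'.lintegral_lt_top hexponent t
  rw [← Measure.restrict_eq_self _ hsub, ← Measure.restrict_eq_self ν' hsub, hrestrict]

lemma IsLevyMeasure.existsUnique (h : IsLevyMeasure μ ν) : ∃! ν, IsLevyMeasure μ ν :=
  ⟨ν, h, fun _ h' => h'.unique h⟩

end LevyMeasure

section SizeBias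

/-- The difference quotient `(1 - exp (-h z)) / h` at `h = 2⁻ⁿ`, which increases to `z`. -/
noncomputable def expSlope (n : ℕ) (z : ℝ) : ℝ :=
  2 ^ n * (1 - Real.exp (-(z / 2 ^ n)))

lemma expSlope_nonneg (n : ℕ) {z : ℝ} (hz : 0 ≤ z) : 0 ≤ expSlope n z :=
  mul_nonneg (by positivity)
    (sub_nonneg.2 (Real.exp_le_one_iff.2 (neg_nonpos.2 (by positivity))))

lemma expSlope_le (n : ℕ) (z : ℝ) : expSlope n z ≤ z := by
  calc expSlope n z ≤ 2 ^ n * (z / 2 ^ n) :=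
        mul_le_mul_of_nonneg_left (by linarith [Real.add_one_le_exp (-(z / 2 ^ n))])
          (by positivity)
    _ = z := mul_div_cancel₀ z (by positivity)

lemma expSlope_le_two_pow (n : ℕ) (z : ℝ) : expSlope n z ≤ 2 ^ n :=
  mul_le_of_le_one_right (by positivity) (sub_le_self _ (Real.exp_pos _).le)

lemma sub_sq_div_le_expSlope (n : ℕ) {z : ℝ} (hz : 0 ≤ z) : z - z ^ 2 / 2 ^ n ≤ expSlope n z := by
  have hx : 0 ≤ z / 2 ^ n := by positivity
  have hexp : Real.exp (-(z / 2 ^ n)) ≤ 1 - z / 2 ^ n + (z / 2 ^ n) ^ 2 := by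
    rw [Real.exp_neg, inv_le_iff_one_le_mul₀ (Real.exp_pos _)]
    calc (1 : ℝ) ≤ (1 - z / 2 ^ n + (z / 2 ^ n) ^ 2) * (z / 2 ^ n + 1) := by
          nlinarith [pow_nonneg hx 3]
      _ ≤ _ := mul_le_mul_of_nonneg_left (Real.add_one_le_exp _)
          (by nlinarith [sq_nonneg (z / 2 ^ n - 1)])
  calc z - z ^ 2 / 2 ^ n = 2 ^ n * (z / 2 ^ n - (z / 2 ^ n) ^ 2) := by field_simp
    _ ≤ expSlope n z := mul_le_mul_of_nonneg_left (by linarith) (by positivity)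

lemma monotone_expSlope (z : ℝ) : Monotone fun n => expSlope n z := by
  refine monotone_nat_of_le_succ fun n => ?_
  have hsq : Real.exp (-(z / 2 ^ n)) = Real.exp (-(z / 2 ^ (n + 1))) ^ 2 := by
    rw [← Real.exp_nat_mul]
    congr 1
    rw [pow_succ]
    push_cast
    field_simp
  have hpow : (0 : ℝ) < 2 ^ n := by positivity
  calc expSlope n z = 2 ^ n * (1 - Real.exp (-(z / 2 ^ (n + 1))) ^ 2) := by rw [expSlope, hsq]
    _ ≤ 2 ^ n * (2 * (1 - Real.exp (-(z / 2 ^ (n + 1))))) :=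
        mul_le_mul_of_nonneg_left
          (by nlinarith [sq_nonneg (1 - Real.exp (-(z / 2 ^ (n + 1))))]) hpow.le
    _ = expSlope (n + 1) z := by rw [expSlope, ← mul_assoc, pow_succ]

lemma tendsto_expSlope {w : ℕ → ℝ} {z : ℝ} (hw : ∀ n, 0 ≤ w n) (h : Tendsto w atTop (𝓝 z)) :
    Tendsto (fun n => expSlope n (w n)) atTop (𝓝 z) := by
  refine tendsto_of_tendsto_of_tendsto_of_le_of_le ?_ h
    (fun n => sub_sq_div_le_expSlope n (hw n)) fun n => expSlope_le n (w n)
  have hzero : Tendsto (fun n => w n ^ 2 / 2 ^ n) atTop (𝓝 0) := by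
    simpa [div_eq_mul_inv, inv_pow] using (h.pow 2).mul
      (tendsto_pow_atTop_nhds_zero_of_lt_one (r := (2 : ℝ)⁻¹) (by norm_num) (by norm_num))
  simpa using h.sub hzero

lemma expSlope_coordinate {ι : Type*} (n : ℕ) (i : ι) (y : ι → ℝ≥0) :
    expSlope n (y i) = 2 ^ n * (1 - pathExp (Finsupp.single i (2 ^ n)⁻¹) y) := by
  rw [expSlope, pathExp_single]
  simp [div_eq_inv_mul]

section Coordinate

variable {ι : Type*} {i : ι} {ν : Measure (ι → ℝ≥0)}

@[fun_prop]
lemma measurable_expSlope (n : ℕ) : Measurable (expSlope n) := by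
  unfold expSlope
  fun_prop

lemma pathExp_mul_expSlope_nonneg (c : ι →₀ ℝ≥0) (n : ℕ) (i : ι) (y : ι → ℝ≥0) :
    0 ≤ pathExp c y * expSlope n (y i) :=
  mul_nonneg (pathExp_pos c y).le (expSlope_nonneg n (y i).2)

lemma pathExp_mul_expSlope_le (c : ι →₀ ℝ≥0) (n : ℕ) (i : ι) (y : ι → ℝ≥0) :
    pathExp c y * expSlope n (y i) ≤ y i :=
  (mul_le_of_le_one_left (expSlope_nonneg n (y i).2) (pathExp_le_one c y)).trans (expSlope_le n _)

lemma integrable_coordinate (hi : ∫⁻ y, (y i : ℝ≥0∞) ∂ν ≠ ∞) :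
    Integrable (fun y => (y i : ℝ)) ν :=
  integrable_toReal_of_lintegral_ne_top (Measurable.aemeasurable (by fun_prop)) hi

lemma tendsto_integral_pathExp_mul_expSlope (hi : ∫⁻ y, (y i : ℝ≥0∞) ∂ν ≠ ∞) (c : ι →₀ ℝ≥0) :
    Tendsto (fun n => ∫ y, pathExp c y * expSlope n (y i) ∂ν) atTop
      (𝓝 (∫ y, pathExp c y * y i ∂ν)) := by
  refine tendsto_integral_of_dominated_convergence (fun y => (y i : ℝ)) (fun n => by fun_prop)
    (integrable_coordinate hi) (fun n => ae_of_all _ fun y => ?_) (ae_of_all _ fun y => ?_)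
  · rw [Real.norm_of_nonneg (pathExp_mul_expSlope_nonneg c n i y)]
    exact pathExp_mul_expSlope_le c n i y
  · exact (tendsto_expSlope (fun _ => (y i).2) tendsto_const_nhds).const_mul _

lemma lintegral_pathExp_mul_expSlope [IsFiniteMeasure ν] (c : ι →₀ ℝ≥0) (n : ℕ) :
    ∫⁻ y, ENNReal.ofReal (pathExp c y * expSlope n (y i)) ∂ν =
      ENNReal.ofReal (∫ y, pathExp c y * expSlope n (y i) ∂ν) := by
  refine (ofReal_integral_eq_lintegral_ofReal
    (.of_bound (by fun_prop) (2 ^ n) (ae_of_all _ fun y => ?_))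
    (ae_of_all _ (pathExp_mul_expSlope_nonneg c n i))).symm
  rw [Real.norm_of_nonneg (pathExp_mul_expSlope_nonneg c n i y)]
  exact (mul_le_of_le_one_left (expSlope_nonneg n (y i).2) (pathExp_le_one c y)).trans
    (expSlope_le_two_pow n _)

end Coordinate

variable {μ ν : Measure TimePath}

lemma IsLevyMeasure.integral_pathExp_mul_one_sub_pathExp [IsFiniteMeasure μ]
    (h : IsLevyMeasure μ ν) (c d : ℝ≥0 →₀ ℝ≥0) :
    ∫ y, pathExp c y * (1 - pathExp d y) ∂μ =
      (∫ y, pathExp c y ∂μ) * (1 - Real.exp (-∫ y, pathExp c y * (1 - pathExp d y) ∂ν)) := by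
  rw [integral_pathExp_mul_one_sub_pathExp_eq_sub h.lintegral_lt_top, mul_sub, mul_one,
    h.integral_pathExp c, ← Real.exp_add, ← h.integral_pathExp c]
  simp only [mul_sub, mul_one, ← pathExp_add_weight]
  rw [integral_sub (integrable_pathExp μ _) (integrable_pathExp μ _), h.integral_pathExp (c + d)]
  ring_nf

lemma IsLevyMeasure.integral_pathExp_mul_expSlope [IsFiniteMeasure μ] (h : IsLevyMeasure μ ν)
    (c : ℝ≥0 →₀ ℝ≥0) (a : ℝ≥0) (n : ℕ) :
    ∫ y, pathExp c y * expSlope n (y a) ∂μ =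
      (∫ y, pathExp c y ∂μ) * expSlope n (∫ y, pathExp c y * expSlope n (y a) ∂ν) := by
  simp only [expSlope_coordinate, mul_left_comm _ ((2 : ℝ) ^ n), integral_const_mul]
  rw [h.integral_pathExp_mul_one_sub_pathExp, expSlope, mul_div_cancel_left₀ _ (by positivity),
    mul_left_comm]

theorem IsLevyMeasure.lintegral_pathExp_mul_coordinate [IsFiniteMeasure μ]
    (h : IsLevyMeasure μ ν) {a : ℝ≥0} (ha : ∫⁻ y, (y a : ℝ≥0∞) ∂ν ≠ ∞) (c : ℝ≥0 →₀ ℝ≥0) :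
    ∫⁻ y, ENNReal.ofReal (pathExp c y * y a) ∂μ =
      ENNReal.ofReal ((∫ y, pathExp c y ∂μ) * ∫ y, pathExp c y * y a ∂ν) := by
  have hmono : Tendsto (fun n => ∫⁻ y, ENNReal.ofReal (pathExp c y * expSlope n (y a)) ∂μ) atTop
      (𝓝 (∫⁻ y, ENNReal.ofReal (pathExp c y * y a) ∂μ)) := by
    refine lintegral_tendsto_of_tendsto_of_monotone
      (fun n => Measurable.aemeasurable (by fun_prop)) (ae_of_all _ fun y m n hmn => ?_)
      (ae_of_all _ fun y => ?_)
    · exact ENNReal.ofReal_le_ofReal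
        (mul_le_mul_of_nonneg_left (monotone_expSlope _ hmn) (pathExp_pos c y).le)
    · exact ENNReal.tendsto_ofReal
        ((tendsto_expSlope (fun _ => (y a).2) tendsto_const_nhds).const_mul _)
  have hlim : Tendsto (fun n => ∫⁻ y, ENNReal.ofReal (pathExp c y * expSlope n (y a)) ∂μ) atTop
      (𝓝 (ENNReal.ofReal ((∫ y, pathExp c y ∂μ) * ∫ y, pathExp c y * y a ∂ν))) := by
    simp only [lintegral_pathExp_mul_expSlope, h.integral_pathExp_mul_expSlope]
    refine ENNReal.tendsto_ofReal ((tendsto_expSlope (fun n => integral_nonneg fun y => ?_)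
      (tendsto_integral_pathExp_mul_expSlope ha c)).const_mul _)
    exact pathExp_mul_expSlope_nonneg c n a y
  exact tendsto_nhds_unique hmono hlim

theorem IsLevyMeasure.lintegral_coordinate [IsProbabilityMeasure μ] (h : IsLevyMeasure μ ν)
    {a : ℝ≥0} (ha : ∫⁻ y, (y a : ℝ≥0∞) ∂ν ≠ ∞) :
    ∫⁻ y, (y a : ℝ≥0∞) ∂μ = ∫⁻ y, (y a : ℝ≥0∞) ∂ν := by
  have h0 := h.lintegral_pathExp_mul_coordinate ha 0
  simp only [pathExp_zero_weight, one_mul, integral_const, probReal_univ, smul_eq_mul,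
    ENNReal.ofReal_coe_nnreal] at h0
  rw [h0, ofReal_integral_eq_lintegral_ofReal (integrable_coordinate ha)
    (ae_of_all _ fun y => (y a).2)]
  simp only [ENNReal.ofReal_coe_nnreal]

theorem IsLevyMeasure.integral_pathExp_mul_coordinate [IsFiniteMeasure μ]
    (h : IsLevyMeasure μ ν) {a : ℝ≥0} (ha : ∫⁻ y, (y a : ℝ≥0∞) ∂ν ≠ ∞) (c : ℝ≥0 →₀ ℝ≥0) :
    ∫ y, pathExp c y * y a ∂μ = (∫ y, pathExp c y ∂μ) * ∫ y, pathExp c y * y a ∂ν := by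
  have hnonneg (y : TimePath) : 0 ≤ pathExp c y * y a := mul_nonneg (pathExp_pos c y).le (y a).2
  rw [integral_eq_lintegral_of_nonneg_ae (ae_of_all _ hnonneg) (by fun_prop),
    h.lintegral_pathExp_mul_coordinate ha, ENNReal.toReal_ofReal]
  exact mul_nonneg (integral_nonneg fun y => (pathExp_pos c y).le) (integral_nonneg hnonneg)

theorem IsLevyMeasure.withDensity_coordinate [IsProbabilityMeasure μ] (h : IsLevyMeasure μ ν)
    {a : ℝ≥0} (ha : ∫⁻ y, (y a : ℝ≥0∞) ∂ν ≠ ∞) :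
    μ.withDensity (fun y => (y a : ℝ≥0∞)) =
      (μ.prod (ν.withDensity fun y => (y a : ℝ≥0∞))).map fun p => p.1 + p.2 := by
  have := isFiniteMeasure_withDensity ha
  have := isFiniteMeasure_withDensity (h.lintegral_coordinate ha ▸ ha)
  refine ext_of_integral_pathExp fun c => ?_
  rw [integral_pathExp_map_add, integral_withDensity_eq_integral_smul (by fun_prop),
    integral_withDensity_eq_integral_smul (by fun_prop)]
  simp only [NNReal.smul_def, smul_eq_mul, mul_comm _ (pathExp c _),
    h.integral_pathExp_mul_coordinate ha]

end SizeBias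

section IndependentIncrements

lemma exists_monotone_seq_range_superset {T : Type*} [LinearOrder T] (s : Finset T)
    (hs : s.Nonempty) : ∃ τ : ℕ → T, Monotone τ ∧ ∀ t ∈ s, t ∈ range τ := by
  have hcard : 0 < s.card := hs.card_pos
  refine ⟨fun k => s.orderEmbOfFin rfl ⟨min k (s.card - 1), by omega⟩, fun k l hkl => ?_,
    fun t ht => ?_⟩
  · refine (s.orderEmbOfFin rfl).monotone ?_
    simp only [Fin.mk_le_mk]
    omega
  · obtain ⟨k, rfl⟩ : t ∈ range (s.orderEmbOfFin rfl) := by rwa [Finset.range_orderEmbOfFin]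
    exact ⟨k, congrArg _ (Fin.ext (min_eq_left (Nat.le_sub_one_of_lt k.2)))⟩

variable {Ω T E : Type*} [MeasurableSpace Ω] {P : Measure Ω} [LinearOrder T] [AddCommGroup E]
  [MeasurableSpace E] [MeasurableAdd₂ E] [MeasurableSub₂ E] {X : T → Ω → E}

lemma indepFun_sub_sub_of_monotone (hX : HasIndepIncrements X P)
    (hmeas : ∀ t, Measurable (X t)) {τ : ℕ → T} (hτ : Monotone τ) {I J : Type*} [Finite J] {m : ℕ}
    {k : I → ℕ} {l : J → ℕ} (hk : ∀ i, k i ≤ m) (hl : ∀ j, m ≤ l j) :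
    IndepFun (fun ω i => X (τ m) ω - X (τ (k i)) ω) (fun ω j => X (τ (l j)) ω - X (τ m) ω) P := by
  have := Fintype.ofFinite J
  let n := Finset.univ.sup l
  have hln (j : J) : l j ≤ n := Finset.le_sup (Finset.mem_univ j)
  have hdisj : Disjoint (Finset.range m) (Finset.Ico m n) := by
    rw [Finset.range_eq_Ico]
    exact Finset.Ico_disjoint_Ico_consecutive 0 m n
  have hindep := (hX.nat hτ).indepFun_finset _ _ hdisj fun i => (hmeas _).sub (hmeas _)
  have hsum := hindep.comp
    (φ := fun x (i : I) => ∑ p ∈ (Finset.Ico (k i) m).attach,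
      x ⟨p, Finset.mem_range.2 (Finset.mem_Ico.1 p.2).2⟩)
    (ψ := fun x (j : J) => ∑ p ∈ (Finset.Ico m (l j)).attach,
      x ⟨p, Finset.Ico_subset_Ico_right (hln j) p.2⟩)
    (by fun_prop) (by fun_prop)
  convert hsum using 1 <;> ext ω i <;> simp only [Function.comp]
  · rw [Finset.sum_attach _ fun p => X (τ (p + 1)) ω - X (τ p) ω,
      Finset.sum_Ico_sub (fun p => X (τ p) ω) (hk i)]
  · rw [Finset.sum_attach _ fun p => X (τ (p + 1)) ω - X (τ p) ω,
      Finset.sum_Ico_sub (fun p => X (τ p) ω) (hl i)]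

theorem indepFun_increments_min_max [IsProbabilityMeasure P] (hX : HasIndepIncrements X P)
    (hmeas : ∀ t, Measurable (X t)) (a : T) :
    IndepFun (fun ω t => X a ω - X (min t a) ω) (fun ω t => X (max t a) ω - X a ω) P := by
  classical
  refine IndepFun.process_indepFun_process (fun t => (hmeas _).sub (hmeas _))
    (fun t => (hmeas _).sub (hmeas _)) fun I J => ?_
  obtain ⟨τ, hτ, hrange⟩ := exists_monotone_seq_range_superset
    (insert a (I.image (min · a) ∪ J.image (max · a))) (Finset.insert_nonempty _ _)
  obtain ⟨m, rfl⟩ := hrange a (Finset.mem_insert_self _ _)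
  have hpast (t : I) : ∃ k ≤ m, τ k = min (t : T) (τ m) := by
    obtain ⟨k, hk⟩ := hrange (min t (τ m)) (Finset.mem_insert_of_mem (Finset.mem_union_left _
      (Finset.mem_image_of_mem _ t.2)))
    exact ⟨min k m, min_le_right _ _, by rw [hτ.map_min, hk, min_assoc, min_self]⟩
  have hfuture (t : J) : ∃ l ≥ m, τ l = max (t : T) (τ m) := by
    obtain ⟨l, hl⟩ := hrange (max t (τ m)) (Finset.mem_insert_of_mem (Finset.mem_union_right _
      (Finset.mem_image_of_mem _ t.2)))
    exact ⟨max l m, le_max_right _ _, by rw [hτ.map_max, hl, max_assoc, max_self]⟩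
  choose k hkm hk using hpast
  choose l hml hl using hfuture
  simpa only [hk, hl] using indepFun_sub_sub_of_monotone hX hmeas hτ hkm hml

end IndependentIncrements

section Subordinator

lemma pathLaw_add {Ω : Type*} [MeasurableSpace Ω] {P : Measure Ω} [IsFiniteMeasure P]
    {X Y : ℝ≥0 → Ω → ℝ≥0} (hX : AEMeasurable (fun ω t => X t ω) P)
    (hY : AEMeasurable (fun ω t => Y t ω) P)
    (hind : IndepFun (fun ω t => X t ω) (fun ω t => Y t ω) P) :
    pathLaw P (fun t ω => X t ω + Y t ω) =
      ((pathLaw P X).prod (pathLaw P Y)).map fun p => p.1 + p.2 := by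
  simp only [pathLaw]
  rw [← (indepFun_iff_map_prod_eq_prod_map_map hX hY).1 hind,
    AEMeasurable.map_map_of_aemeasurable (by fun_prop) (hX.prodMk hY)]
  rfl
variable {Ω : Type*} [MeasurableSpace Ω] {P : Measure Ω} {ψ : ℝ≥0 → Ω → ℝ≥0}

lemma IsSubordinator.measurable_path (hψ : IsSubordinator P ψ) : Measurable fun ω t => ψ t ω :=
  measurable_pi_lambda _ hψ.measurable

lemma IsSubordinator.measurable_past (hψ : IsSubordinator P ψ) (a : ℝ≥0) :
    Measurable fun ω t => ψ (min t a) ω :=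
  measurable_pi_lambda _ fun _ => hψ.measurable _

lemma IsSubordinator.measurable_future (hψ : IsSubordinator P ψ) (a : ℝ≥0) :
    Measurable fun ω t => ψ (max t a) ω - ψ a ω :=
  measurable_pi_lambda _ fun _ => (hψ.measurable _).sub (hψ.measurable _)

lemma IsSubordinator.ae_past_add_future (hψ : IsSubordinator P ψ) (a : ℝ≥0) :
    ∀ᵐ ω ∂P, ∀ t, ψ (max t a) ω - ψ a ω + ψ (min t a) ω = ψ t ω := by
  filter_upwards [hψ.paths] with ω ⟨hmono, _⟩ t
  rcases le_total t a with h | h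
  · simp [h]
  · rw [min_eq_right h, max_eq_left h, tsub_add_cancel_of_le (hmono h)]

lemma IsSubordinator.integral_exp_sub (hψ : IsSubordinator P ψ) {s t : ℝ≥0} (hst : s ≤ t) (u : ℝ) :
    ∫ ω, Real.exp (-(u * (ψ t ω - ψ s ω : ℝ≥0))) ∂P = ∫ ω, Real.exp (-(u * ψ (t - s) ω)) ∂P := by
  have hstat := ((hψ.stationary s (t - s)).comp
    (u := fun x : ℝ => Real.exp (-(u * x))) (by fun_prop)).integral_eq
  rw [add_tsub_cancel_of_le hst] at hstat
  refine (integral_congr_ae ?_).trans hstat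
  filter_upwards [hψ.paths] with ω ⟨hmono, _⟩
  simp only [Function.comp_apply, NNReal.coe_sub (hmono hst)]

variable [IsProbabilityMeasure P]

theorem IsSubordinator.indepFun_past_future (hψ : IsSubordinator P ψ) (a : ℝ≥0) :
    IndepFun (fun ω t => ψ (min t a) ω) (fun ω t => ψ (max t a) ω - ψ a ω) P := by
  have hincr := indepFun_increments_min_max hψ.indep (fun t => (hψ.measurable t).coe_nnreal_real) a
  have hcomp := hincr.comp
    (φ := fun x (t : ℝ≥0) => (x 0 - x t).toNNReal) (ψ := fun x (t : ℝ≥0) => (x t).toNNReal)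
    (by fun_prop) (by fun_prop)
  refine hcomp.congr ?_ (ae_of_all _ fun ω => ?_)
  · filter_upwards [hψ.zero] with ω h0
    ext1 t
    simp [h0]
  · ext1 t
    simp [NNReal.sub_def]

theorem IsSubordinator.pathLaw_eq_map_add (hψ : IsSubordinator P ψ) (a : ℝ≥0) :
    ((pathLaw P fun t ω => ψ (max t a) ω - ψ a ω).prod
      (pathLaw P fun t ω => ψ (min t a) ω)).map (fun p => p.1 + p.2) = pathLaw P ψ := by
  rw [← pathLaw_add (hψ.measurable_future a).aemeasurable (hψ.measurable_past a).aemeasurable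
    (hψ.indepFun_past_future a).symm]
  refine Measure.map_congr ?_
  filter_upwards [hψ.ae_past_add_future a] with ω hω
  exact funext hω

lemma IsSubordinator.integral_exp_add (hψ : IsSubordinator P ψ) (u : ℝ) (s t : ℝ≥0) :
    ∫ ω, Real.exp (-(u * ψ (s + t) ω)) ∂P =
      (∫ ω, Real.exp (-(u * ψ s ω)) ∂P) * ∫ ω, Real.exp (-(u * ψ t ω)) ∂P := by
  have hexp (r : ℝ≥0) : Measurable fun y : TimePath => Real.exp (-(u * y r)) := by fun_prop
  have hindep := ((hψ.indepFun_past_future s).comp (hexp s)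
    (hexp (s + t))).integral_fun_mul_eq_mul_integral
    ((hexp s).comp (hψ.measurable_past s)).aestronglyMeasurable
    ((hexp (s + t)).comp (hψ.measurable_future s)).aestronglyMeasurable
  simp only [Function.comp_apply, min_self, max_eq_left (le_self_add : s ≤ s + t)] at hindep
  rw [hψ.integral_exp_sub le_self_add, add_tsub_cancel_left] at hindep
  rw [← hindep]
  refine integral_congr_ae ?_
  filter_upwards [hψ.paths] with ω ⟨hmono, _⟩
  rw [← Real.exp_add, NNReal.coe_sub (hmono le_self_add)]
  ring_nf

end Subordinator

section LaplaceExponent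

lemma eq_mul_of_additive_of_nonneg {f : ℝ≥0 → ℝ} (hadd : ∀ s t, f (s + t) = f s + f t)
    (hf : ∀ t, 0 ≤ f t) (t : ℝ≥0) : f t = t * f 1 := by
  have hmono : Monotone f := fun s t hst => by
    rw [← add_tsub_cancel_of_le hst, hadd]
    exact le_add_of_nonneg_right (hf _)
  let g : ℝ≥0 →+ ℝ := AddMonoidHom.mk' f hadd
  have hmul (n : ℕ) (s : ℝ≥0) : f (n * s) = n * f s := by
    simpa [g] using map_nsmul g n s
  have hnat (n : ℕ) : f n = n * f 1 := by simpa using hmul n 1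
  have hbound (n : ℕ) : n * |f t - t * f 1| ≤ f 1 := by
    let k := ⌊(n : ℝ≥0) * t⌋₊
    have hk : (k : ℝ≥0) ≤ n * t := Nat.floor_le zero_le
    have hk' : (n : ℝ≥0) * t ≤ (k + 1 : ℕ) := by exact_mod_cast (Nat.lt_floor_add_one _).le
    have hlower : k * f 1 ≤ n * f t := by simpa only [hnat, hmul] using hmono hk
    have hupper : n * f t ≤ (k + 1 : ℕ) * f 1 := by simpa only [hnat, hmul] using hmono hk'
    rw [← NNReal.coe_le_coe] at hk hk'
    push_cast at hk hk' hupper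
    rw [← Nat.abs_cast n, ← abs_mul, abs_le]
    constructor <;> nlinarith [hf 1]
  by_contra hne
  obtain ⟨n, hn⟩ := exists_nat_gt (f 1 / |f t - t * f 1|)
  rw [div_lt_iff₀ (abs_pos.2 (sub_ne_zero.2 hne))] at hn
  exact (hbound n).not_gt hn

variable {Ω : Type*} [MeasurableSpace Ω] {P : Measure Ω} {ψ : ℝ≥0 → Ω → ℝ≥0}

/-- The Laplace exponent `φ` of a subordinator, characterized by
`E exp (-u ψ(t)) = exp (-t φ(u))`. -/
noncomputable def laplaceExponent (P : Measure Ω) (ψ : ℝ≥0 → Ω → ℝ≥0) (u : ℝ≥0) : ℝ :=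
  -Real.log (∫ ω, Real.exp (-(u * ψ 1 ω : ℝ)) ∂P)

variable [IsProbabilityMeasure P]

lemma laplaceExponent_zero : laplaceExponent P ψ 0 = 0 := by
  simp [laplaceExponent]

lemma IsSubordinator.integrable_exp (hψ : IsSubordinator P ψ) (u t : ℝ≥0) :
    Integrable (fun ω => Real.exp (-(u * ψ t ω : ℝ))) P := by
  have := hψ.measurable t
  refine .of_bound (by fun_prop) 1 (ae_of_all _ fun ω => ?_)
  rw [Real.norm_eq_abs, Real.abs_exp, Real.exp_le_one_iff]
  exact neg_nonpos.2 (by positivity)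

lemma IsSubordinator.monotone_laplaceExponent (hψ : IsSubordinator P ψ) :
    Monotone (laplaceExponent P ψ) := fun u v huv =>
  neg_le_neg <| Real.log_le_log (integral_exp_pos (hψ.integrable_exp v 1)) <|
    integral_mono (hψ.integrable_exp v 1) (hψ.integrable_exp u 1) fun ω => by
      dsimp only
      gcongr

theorem IsSubordinator.integral_exp (hψ : IsSubordinator P ψ) (u t : ℝ≥0) :
    ∫ ω, Real.exp (-(u * ψ t ω : ℝ)) ∂P = Real.exp (-(t * laplaceExponent P ψ u)) := by
  let f (t : ℝ≥0) : ℝ := -Real.log (∫ ω, Real.exp (-(u * ψ t ω : ℝ)) ∂P)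
  have hpos (t : ℝ≥0) : 0 < ∫ ω, Real.exp (-(u * ψ t ω : ℝ)) ∂P :=
    integral_exp_pos (hψ.integrable_exp u t)
  have hadd (s t : ℝ≥0) : f (s + t) = f s + f t := by
    simp only [f, hψ.integral_exp_add, Real.log_mul (hpos s).ne' (hpos t).ne', neg_add]
  have hnonneg (t : ℝ≥0) : 0 ≤ f t := by
    refine neg_nonneg.2 (Real.log_nonpos (hpos t).le ?_)
    calc ∫ ω, Real.exp (-(u * ψ t ω : ℝ)) ∂P ≤ ∫ _, 1 ∂P :=
          integral_mono (hψ.integrable_exp u t) (integrable_const 1) fun ω =>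
            Real.exp_le_one_iff.2 (neg_nonpos.2 (by positivity))
      _ = 1 := by simp
  have hlinear : f t = t * laplaceExponent P ψ u := eq_mul_of_additive_of_nonneg hadd hnonneg t
  rw [← hlinear, neg_neg, Real.exp_log (hpos t)]

end LaplaceExponent

section TailWeight

/-- The total weight that `c` puts on the times not before `s`. -/
noncomputable def tailWeight (c : ℝ≥0 →₀ ℝ≥0) (s : ℝ) : ℝ≥0 :=
  Finsupp.linearCombination ℝ≥0 (fun t : ℝ≥0 => if s ≤ t then 1 else 0) c

lemma tailWeight_add (c d : ℝ≥0 →₀ ℝ≥0) (s : ℝ) :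
    tailWeight (c + d) s = tailWeight c s + tailWeight d s :=
  map_add _ c d

lemma tailWeight_single (r u : ℝ≥0) (s : ℝ) :
    tailWeight (Finsupp.single r u) s = if s ≤ r then u else 0 := by
  simp [tailWeight]

lemma tailWeight_eq_zero {c : ℝ≥0 →₀ ℝ≥0} {s : ℝ} (hs : ∀ t ∈ c.support, (t : ℝ) < s) :
    tailWeight c s = 0 := by
  rw [tailWeight, Finsupp.linearCombination_apply]
  exact Finset.sum_eq_zero fun t ht => by simp [(hs t ht).not_ge]

lemma tailWeight_mapDomain_min (c : ℝ≥0 →₀ ℝ≥0) (a : ℝ≥0) (s : ℝ) :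
    tailWeight (c.mapDomain (min · a)) s = if s ≤ a then tailWeight c s else 0 := by
  rw [tailWeight, Finsupp.linearCombination_mapDomain]
  split_ifs with h
  · simp [tailWeight, Function.comp_def, h]
  · simp [Finsupp.linearCombination_apply, h]

lemma antitone_tailWeight (c : ℝ≥0 →₀ ℝ≥0) : Antitone (tailWeight c) := fun s s' hss' => by
  simp only [tailWeight, Finsupp.linearCombination_apply, Finsupp.sum, smul_eq_mul]
  gcongr with t
  split_ifs with h h'
  · exact le_rfl
  · exact absurd (hss'.trans h) h'
  · exact zero_le
  · exact le_rfl

lemma stepPath_toNNReal_apply (x : ℝ≥0) (s : ℝ) (t : ℝ≥0) :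
    stepPath x s.toNNReal t = if s ≤ t then x else 0 := by
  simp [stepPath, indicator_apply, Real.toNNReal_le_iff_le_coe]

lemma pathExp_stepPath (c : ℝ≥0 →₀ ℝ≥0) (x : ℝ≥0) (s : ℝ) :
    pathExp c (stepPath x s.toNNReal) = Real.exp (-(tailWeight c s * x)) := by
  rw [pathExp, tailWeight, ← NNReal.coe_mul, mul_comm, Finsupp.linearCombination_apply,
    Finsupp.linearCombination_apply, Finsupp.mul_sum]
  congr 4
  ext t
  simp [stepPath_toNNReal_apply, mul_comm]

variable {φ : ℝ≥0 → ℝ}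

lemma integrableOn_comp_tailWeight (hφ : Monotone φ) (hφ0 : φ 0 = 0) (c : ℝ≥0 →₀ ℝ≥0) :
    IntegrableOn (fun s => φ (tailWeight c s)) (Ioi 0) := by
  have hanti : Antitone fun s => φ (tailWeight c s) := hφ.comp_antitone (antitone_tailWeight c)
  have hIcc : IntegrableOn (fun s => φ (tailWeight c s)) (Icc 0 (c.support.sup id : ℝ≥0)) :=
    hanti.antitoneOn _ |>.integrableOn_isCompact isCompact_Icc
  refine hIcc.of_forall_sdiff_eq_zero measurableSet_Ioi fun s ⟨hs, hs'⟩ => ?_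
  have hlt (t) (ht : t ∈ c.support) : (t : ℝ) < s :=
    (NNReal.coe_le_coe.2 (Finset.le_sup (f := id) ht)).trans_lt
      (not_le.1 fun h => hs' ⟨(mem_Ioi.1 hs).le, h⟩)
  rw [tailWeight_eq_zero hlt, hφ0]

lemma setIntegral_comp_tailWeight_single (hφ0 : φ 0 = 0) (r u : ℝ≥0) :
    ∫ s in Ioi (0 : ℝ), φ (tailWeight (Finsupp.single r u) s) = r * φ u := by
  have hind (s : ℝ) : φ (tailWeight (Finsupp.single r u) s) =
      (Iic (r : ℝ)).indicator (fun _ => φ u) s := by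
    by_cases h : s ≤ r <;> simp [tailWeight_single, h, hφ0]
  simp_rw [hind]
  rw [setIntegral_indicator measurableSet_Iic, Ioi_inter_Iic]
  simp

lemma setIntegral_comp_tailWeight_add_single (hφ : Monotone φ) (hφ0 : φ 0 = 0)
    {c : ℝ≥0 →₀ ℝ≥0} {a r : ℝ≥0} (hc : ∀ t ∈ c.support, t ≤ a) (har : a ≤ r) (u : ℝ≥0) :
    ∫ s in Ioi (0 : ℝ), φ (tailWeight (c + Finsupp.single r u) s) =
      (∫ s in Ioi (0 : ℝ), φ (tailWeight (c + Finsupp.single a u) s)) + (r - a) * φ u := by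
  have hsplit (s : ℝ) : φ (tailWeight (c + Finsupp.single r u) s) =
      φ (tailWeight (c + Finsupp.single a u) s) + (Ioc (a : ℝ) r).indicator (fun _ => φ u) s := by
    simp only [tailWeight_add, tailWeight_single, indicator_apply, mem_Ioc]
    rcases le_or_gt s a with hsa | has
    · simp [hsa, hsa.trans (NNReal.coe_le_coe.2 har), hsa.not_gt]
    · have hzero : tailWeight c s = 0 :=
        tailWeight_eq_zero fun t ht => (NNReal.coe_le_coe.2 (hc t ht)).trans_lt has
      by_cases hsr : s ≤ r <;> simp [hzero, has, has.not_ge, hsr, hφ0]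
  have hInter : Ioi (0 : ℝ) ∩ Ioc a r = Ioc (a : ℝ) r :=
    inter_eq_right.2 fun s hs => a.coe_nonneg.trans_lt hs.1
  simp_rw [hsplit]
  rw [integral_add (integrableOn_comp_tailWeight hφ hφ0 _)
    ((integrable_indicator_iff measurableSet_Ioc).2 (by simp)),
    setIntegral_indicator measurableSet_Ioc, hInter]
  simp [har]

end TailWeight

section FiniteDimensional

variable {Ω : Type*} [MeasurableSpace Ω] {P : Measure Ω} {ψ : ℝ≥0 → Ω → ℝ≥0}

lemma IsSubordinator.integral_pathExp_past_eq (hψ : IsSubordinator P ψ) (a : ℝ≥0)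
    (c : ℝ≥0 →₀ ℝ≥0) :
    ∫ y, pathExp c y ∂(pathLaw P fun t ω => ψ (min t a) ω) =
      ∫ y, pathExp (c.mapDomain (min · a)) y ∂(pathLaw P ψ) := by
  rw [pathLaw, integral_map (hψ.measurable_past a).aemeasurable (by fun_prop), pathLaw,
    integral_map hψ.measurable_path.aemeasurable (by fun_prop)]
  simp only [pathExp_mapDomain, Function.comp_def]

variable [IsProbabilityMeasure P]

lemma IsSubordinator.isProbabilityMeasure_pathLaw (hψ : IsSubordinator P ψ) :
    IsProbabilityMeasure (pathLaw P ψ) :=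
  Measure.isProbabilityMeasure_map hψ.measurable_path.aemeasurable

lemma IsSubordinator.isProbabilityMeasure_past (hψ : IsSubordinator P ψ) (a : ℝ≥0) :
    IsProbabilityMeasure (pathLaw P fun t ω => ψ (min t a) ω) :=
  Measure.isProbabilityMeasure_map (hψ.measurable_past a).aemeasurable

lemma IsSubordinator.isProbabilityMeasure_future (hψ : IsSubordinator P ψ) (a : ℝ≥0) :
    IsProbabilityMeasure (pathLaw P fun t ω => ψ (max t a) ω - ψ a ω) :=
  Measure.isProbabilityMeasure_map (hψ.measurable_future a).aemeasurable

lemma IsSubordinator.integral_pathExp_eq_future_mul_past (hψ : IsSubordinator P ψ) (a : ℝ≥0)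
    (c : ℝ≥0 →₀ ℝ≥0) :
    ∫ y, pathExp c y ∂(pathLaw P ψ) =
      (∫ y, pathExp c y ∂(pathLaw P fun t ω => ψ (max t a) ω - ψ a ω)) *
        ∫ y, pathExp c y ∂(pathLaw P fun t ω => ψ (min t a) ω) := by
  have := hψ.isProbabilityMeasure_past a
  have := hψ.isProbabilityMeasure_future a
  rw [← integral_pathExp_map_add, hψ.pathLaw_eq_map_add]

lemma IsSubordinator.integral_pathExp_single (hψ : IsSubordinator P ψ) (r u : ℝ≥0) :
    ∫ y, pathExp (Finsupp.single r u) y ∂(pathLaw P ψ) =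
      Real.exp (-(r * laplaceExponent P ψ u)) := by
  rw [pathLaw, integral_map hψ.measurable_path.aemeasurable (by fun_prop)]
  simp only [pathExp_single, hψ.integral_exp]

lemma IsSubordinator.integral_pathExp_add_single (hψ : IsSubordinator P ψ) {c : ℝ≥0 →₀ ℝ≥0}
    {a r : ℝ≥0} (hc : ∀ t ∈ c.support, t ≤ a) (har : a ≤ r) (u : ℝ≥0) :
    ∫ y, pathExp (c + Finsupp.single r u) y ∂(pathLaw P ψ) =
      (∫ y, pathExp (c + Finsupp.single a u) y ∂(pathLaw P ψ)) *
        Real.exp (-((r - a) * laplaceExponent P ψ u)) := by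
  have hfuture : ∫ y, pathExp (c + Finsupp.single r u) y
      ∂(pathLaw P fun t ω => ψ (max t a) ω - ψ a ω) =
      Real.exp (-((r - a) * laplaceExponent P ψ u)) := by
    have hvanish (ω : Ω) : pathExp c (fun t => ψ (max t a) ω - ψ a ω) = 1 := by
      rw [pathExp, Finsupp.linearCombination_apply, Finsupp.sum,
        Finset.sum_eq_zero fun t ht => by simp [max_eq_right (hc t ht)]]
      simp
    rw [pathLaw, integral_map (hψ.measurable_future a).aemeasurable (by fun_prop)]
    simp only [pathExp_add_weight, hvanish, one_mul, pathExp_single, max_eq_left har]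
    rw [hψ.integral_exp_sub har, hψ.integral_exp, NNReal.coe_sub har]
  have hpast : (c + Finsupp.single r u).mapDomain (min · a) = c + Finsupp.single a u := by
    rw [Finsupp.mapDomain_add, Finsupp.mapDomain_single, min_eq_right har]
    congr 1
    exact (Finsupp.mapDomain_congr fun t ht => min_eq_left (hc t ht)).trans Finsupp.mapDomain_id
  rw [hψ.integral_pathExp_eq_future_mul_past a, hfuture, hψ.integral_pathExp_past_eq, hpast,
    mul_comm]

theorem IsSubordinator.integral_pathExp (hψ : IsSubordinator P ψ) (c : ℝ≥0 →₀ ℝ≥0) :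
    ∫ y, pathExp c y ∂(pathLaw P ψ) =
      Real.exp (-∫ s in Ioi (0 : ℝ), laplaceExponent P ψ (tailWeight c s)) := by
  suffices H : ∀ r u : ℝ≥0, (∀ t ∈ c.support, t ≤ r) →
      ∫ y, pathExp (c + Finsupp.single r u) y ∂(pathLaw P ψ) = Real.exp
        (-∫ s in Ioi (0 : ℝ), laplaceExponent P ψ (tailWeight (c + Finsupp.single r u) s)) by
    simpa using H (c.support.sup id) 0 fun t => Finset.le_sup (f := id)
  induction c using Finsupp.induction_on_max with
  | zero =>
    intro r u _
    rw [zero_add, hψ.integral_pathExp_single,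
      setIntegral_comp_tailWeight_single laplaceExponent_zero]
  | single_add a b c hmax hb ih =>
    intro r u hr
    have hsupp : ∀ t ∈ (Finsupp.single a b + c).support, t ≤ a := fun t ht => by
      rcases Finset.mem_union.1 (Finsupp.support_add ht) with ht | ht
      · exact (Finset.mem_singleton.1 (Finsupp.support_single_subset ht)).le
      · exact (hmax t ht).le
    have har : a ≤ r := hr a <| by
      simpa [Finsupp.notMem_support_iff.1 fun h => (hmax a h).false] using hb
    have hmerge : Finsupp.single a b + c + Finsupp.single a u = c + Finsupp.single a (b + u) := by
      rw [Finsupp.single_add, add_comm (Finsupp.single a b), add_assoc]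
    rw [hψ.integral_pathExp_add_single hsupp har, setIntegral_comp_tailWeight_add_single
      hψ.monotone_laplaceExponent laplaceExponent_zero hsupp har, hmerge,
      ih a (b + u) fun t ht => (hmax t ht).le, neg_add, Real.exp_add]

theorem IsSubordinator.integral_pathExp_past (hψ : IsSubordinator P ψ) (a : ℝ≥0)
    (c : ℝ≥0 →₀ ℝ≥0) :
    ∫ y, pathExp c y ∂(pathLaw P fun t ω => ψ (min t a) ω) =
      Real.exp (-∫ s in Ioc (0 : ℝ) a, laplaceExponent P ψ (tailWeight c s)) := by
  have hind (s : ℝ) : laplaceExponent P ψ (tailWeight (c.mapDomain (min · a)) s) =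
      (Iic (a : ℝ)).indicator (fun s => laplaceExponent P ψ (tailWeight c s)) s := by
    by_cases h : s ≤ a <;> simp [tailWeight_mapDomain_min, h, laplaceExponent_zero]
  simp_rw [hψ.integral_pathExp_past_eq, hψ.integral_pathExp, hind]
  rw [setIntegral_indicator measurableSet_Iic, Ioi_inter_Iic]

theorem IsSubordinator.integral_pathExp_future (hψ : IsSubordinator P ψ) (a : ℝ≥0)
    (c : ℝ≥0 →₀ ℝ≥0) :
    ∫ y, pathExp c y ∂(pathLaw P fun t ω => ψ (max t a) ω - ψ a ω) =
      Real.exp (-∫ s in Ioi (a : ℝ), laplaceExponent P ψ (tailWeight c s)) := by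
  have hintegr := integrableOn_comp_tailWeight hψ.monotone_laplaceExponent laplaceExponent_zero c
  have hfactor := hψ.integral_pathExp_eq_future_mul_past a c
  rw [hψ.integral_pathExp, hψ.integral_pathExp_past, ← Ioc_union_Ioi_eq_Ioi a.coe_nonneg,
    setIntegral_union Ioc_disjoint_Ioi_same measurableSet_Ioi
      (hintegr.mono_set Ioc_subset_Ioi_self) (hintegr.mono_set (Ioi_subset_Ioi a.coe_nonneg)),
    neg_add_rev, Real.exp_add] at hfactor
  exact (mul_right_cancel₀ (Real.exp_ne_zero _) hfactor).symm

end FiniteDimensional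

section InfinitelyDivisible

lemma pathExp_sum {ι κ : Type*} (c : ι →₀ ℝ≥0) (s : Finset κ) (x : κ → ι → ℝ≥0) :
    pathExp c (∑ k ∈ s, x k) = ∏ k ∈ s, pathExp c (x k) := by
  classical
  induction s using Finset.induction_on with
  | empty => simp [pathExp, Finsupp.linearCombination_apply]
  | insert k s hk ih => rw [Finset.sum_insert hk, pathExp_add, ih, Finset.prod_insert hk]

lemma integral_pathExp_map_sum {ι : Type*} (ρ : Measure (ι → ℝ≥0)) [SigmaFinite ρ] (n : ℕ)
    (c : ι →₀ ℝ≥0) :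
    ∫ y, pathExp c y ∂((Measure.pi fun _ : Fin n => ρ).map fun x => ∑ k, x k) =
      (∫ y, pathExp c y ∂ρ) ^ n := by
  rw [integral_map (by fun_prop) (by fun_prop)]
  simp only [pathExp_sum, integral_fintype_prod_eq_pow, Fintype.card_fin]

lemma isInfDivLaw_of_map_sum {μ : Measure TimePath} [IsProbabilityMeasure μ]
    (h : ∀ n : ℕ, n ≠ 0 → ∃ ρ : Measure TimePath, IsProbabilityMeasure ρ ∧
      (Measure.pi fun _ : Fin n => ρ).map (fun x => ∑ k, x k) = μ) : IsInfDivLaw μ := by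
  refine ⟨inferInstance, fun I n hn => ?_⟩
  obtain ⟨ρ, hρ, rfl⟩ := h n (by omega)
  let eval (y : TimePath) (t : I) : ℝ := y t
  have heval : Measurable eval := by fun_prop
  have hρI : IsProbabilityMeasure (ρ.map eval) :=
    Measure.isProbabilityMeasure_map heval.aemeasurable
  refine ⟨ρ.map eval, hρI, ?_⟩
  rw [← Measure.pi_map_pi fun _ => heval.aemeasurable, Measure.map_map (by fun_prop) (by fun_prop),
    Measure.map_map (by fun_prop) (by fun_prop)]
  congr 1
  ext x t
  simp [eval, Finset.sum_apply]

lemma isInfDivLaw_of_pow_integral_pathExp {μ : Measure TimePath} [IsProbabilityMeasure μ]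
    (h : ∀ n : ℕ, n ≠ 0 → ∃ ρ : Measure TimePath, IsProbabilityMeasure ρ ∧
      ∀ c, (∫ y, pathExp c y ∂ρ) ^ n = ∫ y, pathExp c y ∂μ) : IsInfDivLaw μ := by
  refine isInfDivLaw_of_map_sum fun n hn => ?_
  obtain ⟨ρ, hρ, hroot⟩ := h n hn
  have : IsFiniteMeasure ((Measure.pi fun _ : Fin n => ρ).map fun x => ∑ k, x k) :=
    Measure.isFiniteMeasure_map _ _
  exact ⟨ρ, hρ, ext_of_integral_pathExp fun c => by rw [integral_pathExp_map_sum, hroot]⟩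

variable {Ω : Type*} [MeasurableSpace Ω] {P : Measure Ω} {ψ : ℝ≥0 → Ω → ℝ≥0}

lemma IsSubordinator.comp_div (hψ : IsSubordinator P ψ) (r : ℝ≥0) :
    IsSubordinator P fun t => ψ (t / r) := by
  have hmono : Monotone fun t : ℝ≥0 => t / r := fun _ _ h => div_le_div_of_nonneg_right h zero_le
  exact
    { measurable := fun t => hψ.measurable _
      zero := by simpa using hψ.zero
      indep := fun n t ht => hψ.indep n _ (hmono.comp ht)
      stationary := fun s t => by simpa only [add_div] using hψ.stationary (s / r) (t / r)
      paths := by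
        filter_upwards [hψ.paths] with ω ⟨hω, hcont⟩
        exact ⟨hω.comp hmono, fun t => ContinuousWithinAt.comp (g := fun t => ψ t ω)
          (hcont (t / r)) (by fun_prop) fun _ h => hmono h⟩ }

variable [IsProbabilityMeasure P]

lemma IsSubordinator.laplaceExponent_comp_div (hψ : IsSubordinator P ψ) (r u : ℝ≥0) :
    laplaceExponent P (fun t => ψ (t / r)) u = laplaceExponent P ψ u / r := by
  rw [laplaceExponent, hψ.integral_exp, Real.log_exp, neg_neg, NNReal.coe_div, NNReal.coe_one,
    one_div_mul_eq_div]

lemma IsSubordinator.exp_neg_setIntegral_comp_div_pow (hψ : IsSubordinator P ψ)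
    (c : ℝ≥0 →₀ ℝ≥0) (S : Set ℝ) {n : ℕ} (hn : n ≠ 0) :
    Real.exp (-∫ s in S, laplaceExponent P (fun t => ψ (t / (n : ℝ≥0))) (tailWeight c s)) ^ n =
      Real.exp (-∫ s in S, laplaceExponent P ψ (tailWeight c s)) := by
  simp only [hψ.laplaceExponent_comp_div, integral_div, ← Real.exp_nat_mul, NNReal.coe_natCast]
  rw [mul_neg, mul_div_cancel₀ _ (Nat.cast_ne_zero.2 hn)]

theorem IsSubordinator.isInfDivLaw_past (hψ : IsSubordinator P ψ) (a : ℝ≥0) :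
    IsInfDivLaw (pathLaw P fun t ω => ψ (min t a) ω) := by
  have := hψ.isProbabilityMeasure_past a
  refine isInfDivLaw_of_pow_integral_pathExp fun n hn =>
    ⟨_, (hψ.comp_div n).isProbabilityMeasure_past a, fun c => ?_⟩
  rw [(hψ.comp_div n).integral_pathExp_past, hψ.exp_neg_setIntegral_comp_div_pow c _ hn,
    hψ.integral_pathExp_past]

theorem IsSubordinator.isInfDivLaw_future (hψ : IsSubordinator P ψ) (a : ℝ≥0) :
    IsInfDivLaw (pathLaw P fun t ω => ψ (max t a) ω - ψ a ω) := by
  have := hψ.isProbabilityMeasure_future a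
  refine isInfDivLaw_of_pow_integral_pathExp fun n hn =>
    ⟨_, (hψ.comp_div n).isProbabilityMeasure_future a, fun c => ?_⟩
  rw [(hψ.comp_div n).integral_pathExp_future, hψ.exp_neg_setIntegral_comp_div_pow c _ hn,
    hψ.integral_pathExp_future]

end InfinitelyDivisible

section Conditioning

lemma IsCondLawAtZero.unique {μ κ κ' : Measure TimePath} {a : ℝ≥0} (h : IsCondLawAtZero μ a κ)
    (h' : IsCondLawAtZero μ a κ') : κ = κ' := by
  have := h.1
  have := h'.1
  refine ext_of_map_restrict fun I => ext_of_forall_integral_eq_of_IsFiniteMeasure fun f => ?_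
  rw [integral_map (by fun_prop) (by fun_prop), integral_map (by fun_prop) (by fun_prop)]
  exact tendsto_nhds_unique (h.2 I f) (h'.2 I f)

lemma tendsto_integral_of_ae_dist_le {Y E : Type*} [MeasurableSpace Y] [PseudoMetricSpace E]
    {ρ : ℝ≥0 → Measure Y} {X : Y → E} {x₀ : E} {g : E → ℝ} (hg : ContinuousAt g x₀)
    (hρ : ∀ ε > 0, IsProbabilityMeasure (ρ ε))
    (hX : ∀ ε : ℝ≥0, ∀ᵐ y ∂ρ ε, dist (X y) x₀ ≤ ε)
    (hintegr : ∀ ε > 0, Integrable (fun y => g (X y)) (ρ ε)) :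
    Tendsto (fun ε => ∫ y, g (X y) ∂ρ ε) (𝓝[>] 0) (𝓝 (g x₀)) := by
  rw [Metric.tendsto_nhds]
  intro δ hδ
  obtain ⟨r, hr, hgr⟩ := Metric.continuousAt_iff.1 hg (δ / 2) (half_pos hδ)
  filter_upwards [Ioo_mem_nhdsGT (Real.toNNReal_pos.2 hr)] with ε ⟨hε, hεr⟩
  have := hρ ε hε
  have hclose : ∀ᵐ y ∂ρ ε, ‖g (X y) - g x₀‖ ≤ δ / 2 := by
    filter_upwards [hX ε] with y hy
    exact (hgr (hy.trans_lt (Real.lt_toNNReal_iff_coe_lt.1 hεr))).le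
  calc dist (∫ y, g (X y) ∂ρ ε) (g x₀) = ‖∫ y, (g (X y) - g x₀) ∂ρ ε‖ := by
        rw [integral_sub (hintegr ε hε) (integrable_const _), dist_eq_norm]
        simp
    _ ≤ δ / 2 := by simpa using norm_integral_le_of_norm_le_const hclose
    _ < δ := half_lt_self hδ

variable {κ η : Measure TimePath} [IsProbabilityMeasure κ] [IsProbabilityMeasure η] {a : ℝ≥0}

lemma cond_map_add_eq (hκ : ∀ᵐ y ∂κ, y a = 0) (ε : ℝ≥0) :
    ((κ.prod η).map fun p => p.1 + p.2)[|{y : TimePath | y a ≤ ε}] =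
      (κ.prod η[|{y : TimePath | y a ≤ ε}]).map fun p => p.1 + p.2 := by
  set A : Set TimePath := {y | y a ≤ ε}
  have hA : MeasurableSet A := measurableSet_le (by fun_prop) (by fun_prop)
  have hadd : Measurable fun p : TimePath × TimePath => p.1 + p.2 := by fun_prop
  have hpre : (fun p : TimePath × TimePath => p.1 + p.2) ⁻¹' A =ᵐ[κ.prod η] univ ×ˢ A := by
    refine eventuallyEq_set.2 ?_
    filter_upwards [Measure.quasiMeasurePreserving_fst.ae hκ] with p hp
    simp [A, hp]
  rw [ProbabilityTheory.cond, ProbabilityTheory.cond, Measure.map_apply hadd hA, measure_congr hpre,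
    Measure.prod_prod, measure_univ, one_mul, Measure.restrict_map hadd hA,
    Measure.restrict_congr_set hpre, ← Measure.prod_restrict, Measure.restrict_univ,
    Measure.prod_smul_right, Measure.map_smul]

theorem isCondLawAtZero_of_map_add (hκ : ∀ᵐ y ∂κ, y a = 0) (hη : ∀ t, ∀ᵐ y ∂η, y t ≤ y a)
    (hpos : ∀ ε > 0, η {y | y a ≤ ε} ≠ 0) :
    IsCondLawAtZero ((κ.prod η).map fun p => p.1 + p.2) a κ := by
  refine ⟨inferInstance, fun I f => ?_⟩
  have hf_meas : Measurable fun y : TimePath => f (I.restrict y) :=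
    f.continuous.measurable.comp (by fun_prop)
  let g (x : I → ℝ≥0) : ℝ := ∫ z, f (I.restrict z + x) ∂κ
  have hg : Continuous g :=
    continuous_of_dominated (bound := fun _ => ‖f‖)
      (fun x => (f.continuous.measurable.comp (by fun_prop)).aestronglyMeasurable)
      (fun x => ae_of_all _ fun z => f.norm_coe_le_norm _) (integrable_const _)
      (ae_of_all _ fun z => f.continuous.comp (by fun_prop))
  have hg_norm (x : I → ℝ≥0) : ‖g x‖ ≤ ‖f‖ := by
    simpa using norm_integral_le_of_norm_le_const (μ := κ)
      (ae_of_all _ fun z => f.norm_coe_le_norm (I.restrict z + x))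
  have hcond (ε : ℝ≥0) (hε : 0 < ε) : IsProbabilityMeasure η[|{y : TimePath | y a ≤ ε}] :=
    cond_isProbabilityMeasure (hpos ε hε)
  have hfubini (ε : ℝ≥0) :
      ∫ y, f (I.restrict y) ∂((κ.prod η).map fun p => p.1 + p.2)[|{y : TimePath | y a ≤ ε}] =
        ∫ y, g (I.restrict y) ∂η[|{y : TimePath | y a ≤ ε}] := by
    have hadd : Measurable fun p : TimePath × TimePath => f (I.restrict (p.1 + p.2)) :=
      f.continuous.measurable.comp (by fun_prop)
    rw [cond_map_add_eq hκ, integral_map (by fun_prop) hf_meas.aestronglyMeasurable,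
      integral_prod_symm]
    · rfl
    · exact .of_bound hadd.aestronglyMeasurable ‖f‖ (ae_of_all _ fun _ => f.norm_coe_le_norm _)
  have hsmall (ε : ℝ≥0) : ∀ᵐ y ∂η[|{y : TimePath | y a ≤ ε}], dist (I.restrict y) 0 ≤ ε := by
    filter_upwards [cond_absolutelyContinuous.ae_le (ae_all_iff.2 fun t : I => hη t),
      ae_cond_mem (measurableSet_le (by fun_prop) (by fun_prop))] with y hy hya
    refine (dist_pi_le_iff ε.coe_nonneg).2 fun t => ?_
    simpa [NNReal.dist_eq] using (hy t).trans hya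
  have hg_meas : Measurable fun y : TimePath => g (I.restrict y) :=
    hg.measurable.comp (by fun_prop)
  have hlim := tendsto_integral_of_ae_dist_le hg.continuousAt hcond hsmall fun ε hε =>
    have := hcond ε hε
    .of_bound hg_meas.aestronglyMeasurable ‖f‖ (ae_of_all _ fun _ => hg_norm _)
  simpa only [hfubini, g, add_zero] using hlim

lemma isComplementLaw_map_add_iff
    (hcond : IsCondLawAtZero ((κ.prod η).map fun p => p.1 + p.2) a κ) (hκ : IsInfDivLaw κ)
    (hη : IsInfDivLaw η) (η' : Measure TimePath) :
    IsComplementLaw ((κ.prod η).map fun p => p.1 + p.2) a η' ↔ η' = η := by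
  constructor
  · rintro ⟨⟨_, -⟩, κ', hcond', -, hadd⟩
    obtain rfl := hcond.unique hcond'
    exact eq_of_map_add_eq hadd
  · rintro rfl
    exact ⟨hη, κ, hcond, hκ, rfl⟩

end Conditioning

section SubordinatorConditioning

variable {Ω : Type*} [MeasurableSpace Ω] {P : Measure Ω} [IsProbabilityMeasure P]
  {ψ : ℝ≥0 → Ω → ℝ≥0} {a : ℝ≥0}

lemma IsSubordinator.measure_le_ne_zero (hψ : IsSubordinator P ψ)
    (hφ : Tendsto (fun u : ℝ≥0 => laplaceExponent P ψ u / u) atTop (𝓝 0)) {ε : ℝ≥0} (hε : 0 < ε) :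
    P {ω | ψ a ω ≤ ε} ≠ 0 := by
  intro hzero
  have hbound (u : ℝ≥0) (hu : 0 < u) : (ε : ℝ) ≤ a * (laplaceExponent P ψ u / u) := by
    have hexp : Real.exp (-(a * laplaceExponent P ψ u)) ≤ Real.exp (-(u * ε)) := by
      rw [← hψ.integral_exp]
      calc ∫ ω, Real.exp (-(u * ψ a ω : ℝ)) ∂P ≤ ∫ _, Real.exp (-(u * ε : ℝ)) ∂P := by
            refine integral_mono_ae (hψ.integrable_exp u a) (integrable_const _) ?_
            filter_upwards [measure_eq_zero_iff_ae_notMem.1 hzero] with ω hω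
            gcongr
            exact (not_le.1 hω).le
        _ = Real.exp (-(u * ε)) := by simp
    rw [mul_div_assoc', le_div_iff₀ (by positivity)]
    linarith [Real.exp_le_exp.1 hexp]
  have hlim : Tendsto (fun u : ℝ≥0 => a * (laplaceExponent P ψ u / u)) atTop (𝓝 0) := by
    simpa using hφ.const_mul (a : ℝ)
  refine (NNReal.coe_pos.2 hε).not_ge (ge_of_tendsto hlim ?_)
  filter_upwards [eventually_gt_atTop 0] with u hu using hbound u hu

theorem IsSubordinator.isCondLawAtZero_future (hψ : IsSubordinator P ψ)
    (hpos : ∀ ε > 0, P {ω | ψ a ω ≤ ε} ≠ 0) :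
    IsCondLawAtZero (pathLaw P ψ) a (pathLaw P fun t ω => ψ (max t a) ω - ψ a ω) := by
  have := hψ.isProbabilityMeasure_past a
  have := hψ.isProbabilityMeasure_future a
  rw [← hψ.pathLaw_eq_map_add a]
  refine isCondLawAtZero_of_map_add ?_ (fun t => ?_) fun ε hε => ?_
  · rw [pathLaw, ae_map_iff (hψ.measurable_future a).aemeasurable
      (measurableSet_eq_fun (by fun_prop) (by fun_prop))]
    simp
  · rw [pathLaw, ae_map_iff (hψ.measurable_past a).aemeasurable
      (measurableSet_le (by fun_prop) (by fun_prop))]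
    filter_upwards [hψ.paths] with ω ⟨hmono, _⟩
    exact hmono (by simp)
  · rw [pathLaw, Measure.map_apply (hψ.measurable_past a)
      (measurableSet_le (by fun_prop) (by fun_prop))]
    simpa using hpos ε hε

theorem IsSubordinator.isCondLawAtZero_iff (hψ : IsSubordinator P ψ)
    (hpos : ∀ ε > 0, P {ω | ψ a ω ≤ ε} ≠ 0) (κ : Measure TimePath) :
    IsCondLawAtZero (pathLaw P ψ) a κ ↔ κ = pathLaw P fun t ω => ψ (max t a) ω - ψ a ω :=
  ⟨fun h => h.unique (hψ.isCondLawAtZero_future hpos),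
    fun h => h ▸ hψ.isCondLawAtZero_future hpos⟩

theorem IsSubordinator.isComplementLaw_iff (hψ : IsSubordinator P ψ)
    (hpos : ∀ ε > 0, P {ω | ψ a ω ≤ ε} ≠ 0) (η : Measure TimePath) :
    IsComplementLaw (pathLaw P ψ) a η ↔ η = pathLaw P fun t ω => ψ (min t a) ω := by
  have := hψ.isProbabilityMeasure_past a
  have := hψ.isProbabilityMeasure_future a
  have hcond := hψ.isCondLawAtZero_future hpos
  rw [← hψ.pathLaw_eq_map_add a] at hcond ⊢
  exact isComplementLaw_map_add_iff hcond (hψ.isInfDivLaw_future a) (hψ.isInfDivLaw_past a) η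

end SubordinatorConditioning

section StepPathMeasure

lemma measurable_stepPath : Measurable fun p : ℝ × ℝ≥0 => stepPath p.2 p.1.toNNReal := by
  refine measurable_pi_lambda _ fun t => ?_
  simp only [stepPath_toNNReal_apply]
  exact Measurable.ite (measurableSet_le (by fun_prop) (by fun_prop)) (by fun_prop) (by fun_prop)

/-- The image of `τ(ds) π(dx)` under `(s, x) ↦ x 1_{[s, ∞)}`: the Lévy measure of an additive
process whose jumps at time `s` occur with intensity `τ(ds)` and have sizes governed by `π`. Times
are real numbers; negative ones are sent to `0`. -/
noncomputable def stepPathMeasure (τ : Measure ℝ) (π : Measure ℝ≥0) : Measure TimePath :=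
  (τ.prod π).map fun p => stepPath p.2 p.1.toNNReal

lemma min_one_le_two_mul_one_sub_exp_neg {z : ℝ} (hz : 0 ≤ z) :
    min z 1 ≤ 2 * (1 - Real.exp (-z)) := by
  have hexp : Real.exp (-z) * (z + 1) ≤ 1 := by
    rw [Real.exp_neg, inv_mul_le_iff₀ (Real.exp_pos z), mul_one]
    exact Real.add_one_le_exp z
  rcases le_total z 1 with h | h
  · rw [min_eq_left h]
    nlinarith [Real.exp_pos (-z)]
  · rw [min_eq_right h]
    nlinarith [Real.exp_pos (-z)]

lemma measure_eq_iSup_subset_diff_zero {ι : Type*} {ν : Measure (ι → ℝ≥0)} {T : Set ι}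
    (hT : T.Countable) (hν : ∀ᵐ y ∂ν, ∃ i ∈ T, y i ≠ 0) {A : Set (ι → ℝ≥0)}
    (hA : MeasurableSet A) :
    ν A = ⨆ (B : Set (ι → ℝ≥0)) (_ : MeasurableSet B) (_ : B ⊆ A \ {0}), ν B := by
  set D : Set (ι → ℝ≥0) := ⋃ i ∈ T, {y | y i ≠ 0}
  have hD : MeasurableSet D := .biUnion hT fun i _ => by measurability
  have hnull : ν Dᶜ = 0 := by
    filter_upwards [hν] with y hy
    simpa [D] using hy
  refine le_antisymm ?_ (iSup_le fun B => iSup_le fun _ => iSup_le fun hBA =>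
    measure_mono (hBA.trans sdiff_subset))
  rw [← measure_inter_conull (s := A) hnull]
  refine le_iSup_of_le (A ∩ D) (le_iSup_of_le (hA.inter hD) (le_iSup_of_le ?_ le_rfl))
  rintro y ⟨hyA, hyD⟩
  refine ⟨hyA, ?_⟩
  rintro rfl
  simp [D] at hyD

variable {τ : Measure ℝ} {π : Measure ℝ≥0}

lemma ae_stepPathMeasure_exists_natCast_ne_zero (hπ : π {0} = 0) :
    ∀ᵐ y ∂(stepPathMeasure τ π), ∃ i ∈ range ((↑) : ℕ → ℝ≥0), y i ≠ 0 := by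
  have hmeas : MeasurableSet {y : TimePath | ∃ i ∈ range ((↑) : ℕ → ℝ≥0), y i ≠ 0} := by
    simp only [exists_range_iff, ofPred_exists]
    exact .iUnion fun n => by measurability
  rw [stepPathMeasure, ae_map_iff measurable_stepPath.aemeasurable hmeas]
  filter_upwards [Measure.quasiMeasurePreserving_snd.ae (measure_eq_zero_iff_ae_notMem.1 hπ)]
    with p hp
  refine ⟨_, ⟨⌈p.1.toNNReal⌉₊, rfl⟩, ?_⟩
  simpa [stepPath, Nat.le_ceil] using hp

variable [SFinite π]

lemma lintegral_stepPathMeasure {F : TimePath → ℝ≥0∞} (hF : Measurable F) :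
    ∫⁻ y, F y ∂(stepPathMeasure τ π) = ∫⁻ s, ∫⁻ x, F (stepPath x s.toNNReal) ∂π ∂τ := by
  rw [stepPathMeasure, lintegral_map hF measurable_stepPath,
    lintegral_prod (fun p : ℝ × ℝ≥0 => F (stepPath p.2 p.1.toNNReal))
      (hF.comp measurable_stepPath).aemeasurable]

variable {φ : ℝ≥0 → ℝ}

lemma lintegral_one_sub_pathExp_stepPathMeasure
    (hφ : ∀ u : ℝ≥0, ∫⁻ x : ℝ≥0, .ofReal (1 - Real.exp (-(u * x : ℝ))) ∂π = .ofReal (φ u))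
    (c : ℝ≥0 →₀ ℝ≥0) :
    ∫⁻ y, .ofReal (1 - pathExp c y) ∂(stepPathMeasure τ π) =
      ∫⁻ s, .ofReal (φ (tailWeight c s)) ∂τ := by
  rw [lintegral_stepPathMeasure (by fun_prop)]
  simp only [pathExp_stepPath, hφ]

theorem isLevyMeasure_stepPathMeasure {μ : Measure TimePath} (hπ : π {0} = 0)
    (hφ : ∀ u : ℝ≥0, ∫⁻ x : ℝ≥0, .ofReal (1 - Real.exp (-(u * x : ℝ))) ∂π = .ofReal (φ u))
    (hφ_nonneg : ∀ u, 0 ≤ φ u) (hintegr : ∀ c, Integrable (fun s => φ (tailWeight c s)) τ)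
    (hμ : ∀ c, ∫ y, pathExp c y ∂μ = Real.exp (-∫ s, φ (tailWeight c s) ∂τ)) :
    IsLevyMeasure μ (stepPathMeasure τ π) where
  laplace I c := by
    simp only [← pathExp_sum_single]
    rw [hμ, integral_eq_lintegral_of_nonneg_ae (ae_of_all _ fun _ => hφ_nonneg _) (hintegr _).1,
      integral_eq_lintegral_of_nonneg_ae
        (ae_of_all _ fun y => sub_nonneg.2 (pathExp_le_one _ y)) (by fun_prop),
      lintegral_one_sub_pathExp_stepPathMeasure hφ]
  lintegral_lt_top t := by
    calc ∫⁻ y, (min (y t) 1 : ℝ≥0) ∂(stepPathMeasure τ π)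
        ≤ ∫⁻ y, 2 * .ofReal (1 - pathExp (Finsupp.single t 1) y) ∂(stepPathMeasure τ π) := by
          refine lintegral_mono fun y => ?_
          rw [← ENNReal.ofReal_coe_nnreal, ← ENNReal.ofReal_ofNat 2,
            ← ENNReal.ofReal_mul zero_le_two]
          refine ENNReal.ofReal_le_ofReal ?_
          simpa [pathExp_single] using min_one_le_two_mul_one_sub_exp_neg (y t).coe_nonneg
      _ = 2 * ∫⁻ s, .ofReal (φ (tailWeight (Finsupp.single t 1) s)) ∂τ := by
          rw [lintegral_const_mul _ (by fun_prop), lintegral_one_sub_pathExp_stepPathMeasure hφ]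
      _ < ∞ := ENNReal.mul_lt_top (by simp) (hintegr _).lintegral_lt_top
  inner _ hA := measure_eq_iSup_subset_diff_zero (countable_range _)
    (ae_stepPathMeasure_exists_natCast_ne_zero hπ) hA

theorem withDensity_coordinate_stepPathMeasure (a : ℝ≥0) :
    (stepPathMeasure τ π).withDensity (fun y => (y a : ℝ≥0∞)) =
      stepPathMeasure (τ.restrict (Iic (a : ℝ))) (π.withDensity (↑)) := by
  refine Measure.ext_of_lintegral _ fun F hF => ?_
  have hstep (s : ℝ) : Measurable fun x : ℝ≥0 => F (stepPath x s.toNNReal) :=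
    hF.comp (measurable_stepPath.comp measurable_prodMk_left)
  rw [lintegral_withDensity_eq_lintegral_mul _ (by fun_prop) hF, lintegral_stepPathMeasure hF,
    lintegral_stepPathMeasure (by fun_prop), ← lintegral_indicator measurableSet_Iic]
  refine lintegral_congr fun s => ?_
  by_cases hs : s ≤ a
  · rw [indicator_of_mem (mem_Iic.2 hs),
      lintegral_withDensity_eq_lintegral_mul _ (by fun_prop) (hstep s)]
    simp [stepPath_toNNReal_apply, hs]
  · simp [stepPath_toNNReal_apply, hs]

end StepPathMeasure

section GammaMeasure

lemma gammaMeasure_eq_withDensity_Ioi (b r : ℝ) :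
    gammaMeasure b r = (volume.restrict (Ioi 0)).withDensity fun x =>
      .ofReal (r ^ b / Real.Gamma b * x ^ (b - 1) * Real.exp (-(r * x))) := by
  rw [gammaMeasure, ← withDensity_indicator measurableSet_Ioi]
  refine withDensity_congr_ae ?_
  filter_upwards [compl_mem_ae_iff.2 (measure_singleton (0 : ℝ))] with x hx
  rcases lt_or_gt_of_ne hx with hneg | hpos
  · rw [gammaPDF_of_neg hneg, indicator_of_notMem (notMem_Ioi.2 hneg.le)]
  · rw [gammaPDF_of_nonneg hpos.le, indicator_of_mem (mem_Ioi.2 hpos)]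

lemma lintegral_gammaMeasure (b r : ℝ) {f : ℝ → ℝ≥0∞} (hf : Measurable f) :
    ∫⁻ x, f x ∂(gammaMeasure b r) = ∫⁻ x in Ioi 0,
      .ofReal (r ^ b / Real.Gamma b * x ^ (b - 1) * Real.exp (-(r * x))) * f x := by
  rw [gammaMeasure_eq_withDensity_Ioi, lintegral_withDensity_eq_lintegral_mul _ (by fun_prop) hf]
  rfl

lemma ae_gammaMeasure_pos (b r : ℝ) : ∀ᵐ x ∂(gammaMeasure b r), 0 < x := by
  rw [gammaMeasure_eq_withDensity_Ioi]
  exact (withDensity_absolutelyContinuous _ _).ae_le (ae_restrict_mem measurableSet_Ioi)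

-- Tilting by `exp (-u x)` turns the `Gamma(b, r)` density into a multiple of the
-- `Gamma(b, r + u)` density.
theorem lintegral_exp_neg_mul_gammaMeasure {b r u : ℝ} (hb : 0 < b) (hr : 0 < r)
    (hru : 0 < r + u) :
    ∫⁻ x, .ofReal (Real.exp (-(u * x))) ∂(gammaMeasure b r) = .ofReal ((r / (r + u)) ^ b) := by
  have := isProbabilityMeasure_gammaMeasure hb hru
  have htotal : ∫⁻ _, 1 ∂(gammaMeasure b (r + u)) = 1 := by simp
  rw [lintegral_gammaMeasure _ _ measurable_const] at htotal
  rw [lintegral_gammaMeasure _ _ (by fun_prop), ← mul_one (ENNReal.ofReal _), ← htotal,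
    ← lintegral_const_mul _ (by fun_prop)]
  refine setLIntegral_congr_fun measurableSet_Ioi fun x _ => ?_
  have hexp : Real.exp (-((r + u) * x)) = Real.exp (-(r * x)) * Real.exp (-(u * x)) := by
    rw [← Real.exp_add]
    ring_nf
  rw [mul_one, ← ENNReal.ofReal_mul' (by positivity), ← ENNReal.ofReal_mul (by positivity), hexp,
    Real.div_rpow hr.le hru.le]
  field_simp

end GammaMeasure

section TemperedJumpMeasure

/-- The jump-size intensity `|Γ(-α)|⁻¹ x ^ (-α - 1) e ^ (-x) dx` on `(0, ∞)` of the tempered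
`α`-stable subordinator. -/
noncomputable def temperedJumpMeasure (α : ℝ) : Measure ℝ≥0 :=
  (ENNReal.ofReal (1 / |Real.Gamma (-α)|) • (volume.restrict (Ioi 0)).withDensity fun x =>
    .ofReal (x ^ (-α - 1) * Real.exp (-x))).map Real.toNNReal

instance (α : ℝ) : SFinite (temperedJumpMeasure α) := by
  unfold temperedJumpMeasure
  infer_instance

lemma lintegral_temperedJumpMeasure (α : ℝ) {f : ℝ≥0 → ℝ≥0∞} (hf : Measurable f) :
    ∫⁻ x, f x ∂(temperedJumpMeasure α) = .ofReal (1 / |Real.Gamma (-α)|) *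
      ∫⁻ x in Ioi 0, f x.toNNReal * .ofReal (x ^ (-α - 1) * Real.exp (-x)) := by
  rw [temperedJumpMeasure, lintegral_map hf measurable_real_toNNReal, lintegral_smul_measure,
    lintegral_withDensity_eq_lintegral_mul _ (by fun_prop) (by fun_prop), smul_eq_mul]
  simp only [Pi.mul_apply, mul_comm]

lemma temperedJumpMeasure_singleton_zero (α : ℝ) : temperedJumpMeasure α {0} = 0 := by
  rw [← lintegral_indicator_one (measurableSet_singleton 0),
    lintegral_temperedJumpMeasure α (measurable_one.indicator (measurableSet_singleton 0))]
  refine mul_eq_zero.2 (Or.inr (setLIntegral_eq_zero measurableSet_Ioi fun x (hx : 0 < x) => ?_))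
  simp [hx]

variable {α : ℝ}

lemma abs_Gamma_neg (hα : α ∈ Ioo 0 1) : |Real.Gamma (-α)| = Real.Gamma (1 - α) / α := by
  have hrec := Real.Gamma_add_one (s := -α) (neg_ne_zero.2 hα.1.ne')
  have hpos : 0 < Real.Gamma (-α + 1) := Real.Gamma_pos_of_pos (by linarith [hα.2])
  rw [sub_eq_neg_add, eq_div_iff hα.1.ne', ← abs_of_pos hpos, hrec, abs_mul, abs_neg,
    abs_of_pos hα.1, mul_comm]

theorem withDensity_coe_temperedJumpMeasure (hα : α ∈ Ioo 0 1) :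
    (temperedJumpMeasure α).withDensity (↑) =
      ENNReal.ofReal α • (gammaMeasure (1 - α) 1).map Real.toNNReal := by
  have hΓ : 0 < Real.Gamma (1 - α) := Real.Gamma_pos_of_pos (by linarith [hα.2])
  have hα0 := hα.1
  refine Measure.ext_of_lintegral _ fun f hf => ?_
  rw [lintegral_withDensity_eq_lintegral_mul _ (by fun_prop) hf,
    lintegral_temperedJumpMeasure α (by fun_prop), lintegral_smul_measure,
    lintegral_map hf measurable_real_toNNReal, lintegral_gammaMeasure _ _ (by fun_prop),
    smul_eq_mul, ← lintegral_const_mul _ (by fun_prop), ← lintegral_const_mul _ (by fun_prop)]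
  refine setLIntegral_congr_fun measurableSet_Ioi fun x (hx : 0 < x) => ?_
  have hpow : x ^ (1 - α - 1) = x * x ^ (-α - 1) := by
    rw [← Real.rpow_one_add' hx.le (by linarith)]
    ring_nf
  have hdensity : 1 / |Real.Gamma (-α)| * (x * (x ^ (-α - 1) * Real.exp (-x))) =
      α * (1 ^ (1 - α) / Real.Gamma (1 - α) * x ^ (1 - α - 1) * Real.exp (-(1 * x))) := by
    rw [abs_Gamma_neg hα, hpow, Real.one_rpow, one_mul]
    field_simp
  have hdensity' := congrArg ENNReal.ofReal hdensity
  rw [ENNReal.ofReal_mul (by positivity), ENNReal.ofReal_mul hx.le,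
    ENNReal.ofReal_mul hα0.le] at hdensity'
  calc ENNReal.ofReal (1 / |Real.Gamma (-α)|) * (.ofReal x * f x.toNNReal *
        .ofReal (x ^ (-α - 1) * Real.exp (-x)))
      = .ofReal (1 / |Real.Gamma (-α)|) * (.ofReal x *
        .ofReal (x ^ (-α - 1) * Real.exp (-x))) * f x.toNNReal := by ring
    _ = _ := by rw [hdensity', mul_assoc]

lemma integral_mul_exp_neg_mul (x u : ℝ) :
    ∫ v in 0..u, x * Real.exp (-(v * x)) = 1 - Real.exp (-(u * x)) := by
  have hderiv (v : ℝ) :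
      HasDerivAt (fun v => -Real.exp (-(v * x))) (x * Real.exp (-(v * x))) v := by
    simpa only [mul_comm] using hasDerivAt_neg_exp_mul_exp (r := x)
  rw [intervalIntegral.integral_eq_sub_of_hasDerivAt (fun v _ => hderiv v)
    (Continuous.intervalIntegrable (by fun_prop) _ _)]
  simp only [zero_mul, neg_zero, Real.exp_zero]
  ring

lemma integral_mul_one_add_rpow (hα : 0 < α) (u : ℝ) :
    ∫ v in 0..u, α * (1 + v) ^ (α - 1) = (1 + u) ^ α - 1 := by
  rw [intervalIntegral.integral_const_mul,
    intervalIntegral.integral_comp_add_left (fun v => v ^ (α - 1)),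
    integral_rpow (Or.inl (by linarith))]
  simp only [sub_add_cancel, add_zero, Real.one_rpow]
  field_simp

lemma ofReal_one_sub_exp_neg_mul (x u : ℝ≥0) :
    ENNReal.ofReal (1 - Real.exp (-(u * x : ℝ))) =
      ∫⁻ v in Ioc 0 (u : ℝ), (x : ℝ≥0∞) * .ofReal (Real.exp (-(v * x))) := by
  rw [← integral_mul_exp_neg_mul, intervalIntegral.integral_of_le u.coe_nonneg,
    ofReal_integral_eq_lintegral_ofReal]
  · simp only [ENNReal.ofReal_mul x.coe_nonneg, ENNReal.ofReal_coe_nnreal]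
  · exact (Continuous.intervalIntegrable (by fun_prop) 0 _).1
  · exact ae_of_all _ fun v => by positivity

lemma lintegral_mul_exp_temperedJumpMeasure (hα : α ∈ Ioo 0 1) {v : ℝ} (hv : 0 < v) :
    ∫⁻ x : ℝ≥0, (x : ℝ≥0∞) * .ofReal (Real.exp (-(v * x))) ∂(temperedJumpMeasure α) =
      .ofReal (α * (1 + v) ^ (α - 1)) := by
  have hgamma : ∫⁻ x, .ofReal (Real.exp (-(v * x.toNNReal))) ∂(gammaMeasure (1 - α) 1) =
      ENNReal.ofReal ((1 + v) ^ (α - 1)) := by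
    rw [← neg_sub 1 α, Real.rpow_neg (by positivity), ← Real.inv_rpow (by positivity),
      ← one_div, ← lintegral_exp_neg_mul_gammaMeasure (by linarith [hα.2]) one_pos (by positivity)]
    refine lintegral_congr_ae ?_
    filter_upwards [ae_gammaMeasure_pos (1 - α) 1] with x hx
    rw [Real.coe_toNNReal x hx.le]
  calc ∫⁻ x : ℝ≥0, (x : ℝ≥0∞) * .ofReal (Real.exp (-(v * x))) ∂(temperedJumpMeasure α)
      = ∫⁻ x : ℝ≥0, .ofReal (Real.exp (-(v * x))) ∂(temperedJumpMeasure α).withDensity (↑) :=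
        (lintegral_withDensity_eq_lintegral_mul _ (by fun_prop) (by fun_prop)).symm
    _ = .ofReal (α * (1 + v) ^ (α - 1)) := by
        rw [withDensity_coe_temperedJumpMeasure hα, lintegral_smul_measure,
          lintegral_map (by fun_prop) measurable_real_toNNReal, hgamma, smul_eq_mul,
          ENNReal.ofReal_mul hα.1.le]

theorem lintegral_one_sub_exp_temperedJumpMeasure (hα : α ∈ Ioo 0 1) (u : ℝ≥0) :
    ∫⁻ x : ℝ≥0, .ofReal (1 - Real.exp (-(u * x : ℝ))) ∂(temperedJumpMeasure α) =
      .ofReal ((1 + u) ^ α - 1) := by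
  have hα0 := hα.1
  have hcont : ContinuousOn (fun v : ℝ => α * (1 + v) ^ (α - 1)) (uIcc 0 u) := by
    refine ContinuousOn.const_mul ?_ _
    refine (by fun_prop : ContinuousOn (fun v : ℝ => 1 + v) _).rpow_const fun v hv => Or.inl ?_
    rw [uIcc_of_le u.coe_nonneg] at hv
    linarith [hv.1]
  simp only [ofReal_one_sub_exp_neg_mul]
  rw [lintegral_lintegral_swap (Measurable.aemeasurable (by fun_prop)),
    setLIntegral_congr_fun measurableSet_Ioc fun v hv =>
      lintegral_mul_exp_temperedJumpMeasure hα hv.1,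
    ← integral_mul_one_add_rpow hα.1, intervalIntegral.integral_of_le u.coe_nonneg,
    ofReal_integral_eq_lintegral_ofReal hcont.intervalIntegrable.1]
  refine ae_restrict_of_forall_mem measurableSet_Ioc fun v hv => ?_
  have := hv.1
  positivity

end TemperedJumpMeasure

section TemperedStable

variable {α : ℝ}

/-- The jump measure of the tempered `α`-stable subordinator with jump times in `S`: the image of
`ds ⊗ |Γ(-α)|⁻¹ x ^ (-α - 1) e ^ (-x) dx` on `S × (0, ∞)` under `(s, x) ↦ x 1_{[s, ∞)}`. -/
noncomputable def temperedLevyMeasure (α : ℝ) (S : Set ℝ) : Measure TimePath :=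
  stepPathMeasure (volume.restrict S) (temperedJumpMeasure α)

lemma lintegral_temperedLevyMeasure (α : ℝ) (S : Set ℝ) {F : TimePath → ℝ≥0∞}
    (hF : Measurable F) :
    ∫⁻ y, F y ∂(temperedLevyMeasure α S) = temperedJumpIntegral α S F := by
  have hmeas : Measurable fun p : ℝ × ℝ => F (stepPath p.2.toNNReal p.1.toNNReal) *
      .ofReal (p.2 ^ (-α - 1) * Real.exp (-p.2)) :=
    (hF.comp (measurable_stepPath.comp (measurable_fst.prodMk measurable_snd.real_toNNReal))).mul
      (by fun_prop)
  rw [temperedLevyMeasure, lintegral_stepPathMeasure hF, temperedJumpIntegral,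
    ← lintegral_const_mul _ hmeas.lintegral_prod_right']
  refine lintegral_congr fun s => ?_
  have hstep : Measurable fun x => F (stepPath x s.toNNReal) :=
    hF.comp (measurable_stepPath.comp measurable_prodMk_left)
  exact lintegral_temperedJumpMeasure α hstep

lemma withDensity_coordinate_temperedLevyMeasure (hα : α ∈ Ioo 0 1) (a : ℝ≥0) :
    (temperedLevyMeasure α (Ioi 0)).withDensity (fun y => (y a : ℝ≥0∞)) =
      ENNReal.ofReal α • stepPathMeasure (volume.restrict (Ioc 0 (a : ℝ)))
        ((gammaMeasure (1 - α) 1).map Real.toNNReal) := by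
  have := isProbabilityMeasure_gammaMeasure (sub_pos.2 hα.2) one_pos
  rw [temperedLevyMeasure, withDensity_coordinate_stepPathMeasure,
    withDensity_coe_temperedJumpMeasure hα, Measure.restrict_restrict measurableSet_Iic, inter_comm,
    Ioi_inter_Iic, stepPathMeasure, Measure.prod_smul_right, Measure.map_smul, stepPathMeasure]

variable {Ω : Type*} [MeasurableSpace Ω] {P : Measure Ω} {ψ : ℝ≥0 → Ω → ℝ≥0}

theorem IsTemperedStableSubordinator.laplaceExponent_eq
    (hψ : IsTemperedStableSubordinator P α ψ) (u : ℝ≥0) :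
    laplaceExponent P ψ u = (1 + u) ^ α - 1 := by
  simp only [laplaceExponent, ← neg_mul, hψ.laplace u u.coe_nonneg, Real.log_exp, neg_sub]

theorem IsTemperedStableSubordinator.tendsto_laplaceExponent_div
    (hψ : IsTemperedStableSubordinator P α ψ) (hα : α ∈ Ioo 0 1) :
    Tendsto (fun u : ℝ≥0 => laplaceExponent P ψ u / u) atTop (𝓝 0) := by
  have hbound (u : ℝ≥0) (hu : 0 < u) : laplaceExponent P ψ u / u ≤ (u : ℝ) ^ (-(1 - α)) := by
    have hadd := Real.rpow_add_le_add_rpow zero_le_one u.coe_nonneg hα.1.le hα.2.le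
    rw [hψ.laplaceExponent_eq, neg_sub, Real.rpow_sub_one (NNReal.coe_pos.2 hu).ne']
    gcongr
    rw [Real.one_rpow] at hadd
    linarith
  have hnonneg (u : ℝ≥0) : 0 ≤ laplaceExponent P ψ u / u := by
    rw [hψ.laplaceExponent_eq]
    have := Real.one_le_rpow (by simp : (1 : ℝ) ≤ 1 + u) hα.1.le
    exact div_nonneg (by linarith) u.coe_nonneg
  refine tendsto_of_tendsto_of_tendsto_of_le_of_le' tendsto_const_nhds
    ((tendsto_rpow_neg_atTop (sub_pos.2 hα.2)).comp (NNReal.tendsto_coe_atTop.2 tendsto_id))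
    (Eventually.of_forall hnonneg) ?_
  filter_upwards [eventually_gt_atTop 0] with u hu using hbound u hu

variable [IsProbabilityMeasure P]

lemma IsTemperedStableSubordinator.isLevyMeasure_temperedLevyMeasure
    (hψ : IsTemperedStableSubordinator P α ψ) (hα : α ∈ Ioo 0 1) {S : Set ℝ} (hS : S ⊆ Ioi 0)
    {μ : Measure TimePath} (hμ : ∀ c, ∫ y, pathExp c y ∂μ =
      Real.exp (-∫ s in S, laplaceExponent P ψ (tailWeight c s))) :
    IsLevyMeasure μ (temperedLevyMeasure α S) := by
  have hsub := hψ.toIsSubordinator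
  refine isLevyMeasure_stepPathMeasure (temperedJumpMeasure_singleton_zero α)
    (φ := laplaceExponent P ψ) (fun u => ?_) (fun u => ?_) (fun c => ?_) hμ
  · rw [hψ.laplaceExponent_eq, lintegral_one_sub_exp_temperedJumpMeasure hα]
  · exact laplaceExponent_zero.ge.trans (hsub.monotone_laplaceExponent zero_le)
  · exact (integrableOn_comp_tailWeight hsub.monotone_laplaceExponent
      laplaceExponent_zero c).mono_set hS

theorem IsTemperedStableSubordinator.isLevyMeasure
    (hψ : IsTemperedStableSubordinator P α ψ) (hα : α ∈ Ioo 0 1) :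
    IsLevyMeasure (pathLaw P ψ) (temperedLevyMeasure α (Ioi 0)) :=
  hψ.isLevyMeasure_temperedLevyMeasure hα subset_rfl hψ.integral_pathExp

theorem IsTemperedStableSubordinator.isLevyMeasure_past
    (hψ : IsTemperedStableSubordinator P α ψ) (hα : α ∈ Ioo 0 1) (a : ℝ≥0) :
    IsLevyMeasure (pathLaw P fun t ω => ψ (min t a) ω) (temperedLevyMeasure α (Ioc 0 (a : ℝ))) :=
  hψ.isLevyMeasure_temperedLevyMeasure hα Ioc_subset_Ioi_self (hψ.integral_pathExp_past a)

theorem IsTemperedStableSubordinator.isLevyMeasure_future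
    (hψ : IsTemperedStableSubordinator P α ψ) (hα : α ∈ Ioo 0 1) (a : ℝ≥0) :
    IsLevyMeasure (pathLaw P fun t ω => ψ (max t a) ω - ψ a ω)
      (temperedLevyMeasure α (Ioi (a : ℝ))) :=
  hψ.isLevyMeasure_temperedLevyMeasure hα (Ioi_subset_Ioi a.coe_nonneg)
    (hψ.integral_pathExp_future a)

end TemperedStable

section WeightedPathLaw

lemma map_withDensity_comp {Ω E : Type*} [MeasurableSpace Ω] [MeasurableSpace E] {P : Measure Ω}
    {X : Ω → E} (hX : AEMeasurable X P) {g : E → ℝ≥0∞} (hg : Measurable g) :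
    (P.withDensity fun ω => g (X ω)).map X = (P.map X).withDensity g := by
  refine Measure.ext_of_lintegral _ fun F hF => ?_
  rw [lintegral_map' hF.aemeasurable (hX.mono_ac (withDensity_absolutelyContinuous _ _)),
    lintegral_withDensity_eq_lintegral_mul₀ (by fun_prop) (by fun_prop),
    lintegral_withDensity_eq_lintegral_mul _ hg hF, lintegral_map' (by fun_prop) hX]
  rfl

lemma lintegral_pathLaw_withDensity {Ω : Type*} [MeasurableSpace Ω] {P : Measure Ω}
    {X : ℝ≥0 → Ω → ℝ≥0} (hX : AEMeasurable (fun ω t => X t ω) P) {w : Ω → ℝ≥0∞}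
    (hw : AEMeasurable w P) {F : TimePath → ℝ≥0∞} (hF : Measurable F) :
    ∫⁻ y, F y ∂(pathLaw (P.withDensity w) X) = ∫⁻ ω, w ω * F (fun t => X t ω) ∂P := by
  rw [pathLaw, lintegral_map' hF.aemeasurable (hX.mono_ac (withDensity_absolutelyContinuous _ _)),
    lintegral_withDensity_eq_lintegral_mul₀ hw (hF.comp_aemeasurable' hX)]
  rfl

lemma pathLaw_withDensity_div {Ω : Type*} [MeasurableSpace Ω] {P : Measure Ω}
    {X : ℝ≥0 → Ω → ℝ≥0} (hX : AEMeasurable (fun ω t => X t ω) P) (a : ℝ≥0) {r : ℝ} (hr : 0 < r) :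
    pathLaw (P.withDensity fun ω => .ofReal (X a ω / r)) X =
      (ENNReal.ofReal r)⁻¹ • (pathLaw P X).withDensity fun y => (y a : ℝ≥0∞) := by
  have hdiv (x : ℝ≥0) : ENNReal.ofReal (x / r) = (.ofReal r)⁻¹ * x := by
    rw [ENNReal.ofReal_div_of_pos hr, ENNReal.ofReal_coe_nnreal, ENNReal.div_eq_inv_mul]
  rw [← withDensity_smul _ (by fun_prop), pathLaw, pathLaw,
    ← map_withDensity_comp hX (by fun_prop)]
  simp only [hdiv, Pi.smul_apply, smul_eq_mul]

lemma hasLaw_of_coe {Ω : Type*} [MeasurableSpace Ω] {P : Measure Ω} {X : Ω → ℝ≥0}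
    {ρ : Measure ℝ} (hX : HasLaw (fun ω => (X ω : ℝ)) ρ P) : HasLaw X (ρ.map Real.toNNReal) P := by
  simpa using HasLaw.fun_comp ⟨measurable_real_toNNReal.aemeasurable, rfl⟩ hX

theorem pathLaw_withDensity_stepPath {Ω E : Type*} [MeasurableSpace Ω] [MeasurableSpace E]
    {P : Measure Ω} [IsFiniteMeasure P] {Z : Ω → E} {X : Ω → ℝ≥0} {ρ : Measure E}
    {π : Measure ℝ≥0} (hZ : HasLaw Z ρ P) (hX : HasLaw X π P) (hind : IndepFun Z X P)
    {T : E → ℝ} (hT : Measurable T) {f : E → ℝ≥0∞} (hf : Measurable f) {g : ℝ≥0 → ℝ≥0∞}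
    (hg : Measurable g) :
    pathLaw (P.withDensity fun ω => f (Z ω) * g (X ω))
        (fun t ω => stepPath (X ω) (T (Z ω)).toNNReal t) =
      stepPathMeasure ((ρ.withDensity f).map T) (π.withDensity g) := by
  have := hZ.isFiniteMeasure_iff.1 ‹_›
  have := hX.isFiniteMeasure_iff.1 ‹_›
  have hlaw : HasLaw (fun ω => (Z ω, X ω)) (ρ.prod π) P :=
    (indepFun_iff_hasLaw_prodMk_prod hZ hX).1 hind
  have hT' : Measurable (Prod.map T id : E × ℝ≥0 → ℝ × ℝ≥0) := hT.prodMap measurable_id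
  calc pathLaw (P.withDensity fun ω => f (Z ω) * g (X ω))
        (fun t ω => stepPath (X ω) (T (Z ω)).toNNReal t)
      = (((P.withDensity fun ω => f (Z ω) * g (X ω)).map fun ω => (Z ω, X ω)).map
          (Prod.map T id)).map fun p => stepPath p.2 p.1.toNNReal := by
        rw [Measure.map_map measurable_stepPath hT', AEMeasurable.map_map_of_aemeasurable
          (measurable_stepPath.comp hT').aemeasurable
          (hlaw.aemeasurable.mono_ac (withDensity_absolutelyContinuous _ _))]
        rfl
    _ = stepPathMeasure ((ρ.withDensity f).map T) (π.withDensity g) := by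
        rw [map_withDensity_comp (g := fun p : E × ℝ≥0 => f p.1 * g p.2) hlaw.aemeasurable
          (by fun_prop), hlaw.map_eq, ← prod_withDensity hf hg,
          ← Measure.map_prod_map _ _ hT measurable_id, Measure.map_id, stepPathMeasure]

lemma map_mul_left_restrict_Icc {a : ℝ} (ha : 0 < a) :
    (volume.restrict (Icc 0 1)).map (a * ·) =
      ENNReal.ofReal a⁻¹ • volume.restrict (Ioc 0 a) := by
  have hpre : (a * ·) ⁻¹' Icc 0 a = Icc 0 1 := by
    rw [preimage_const_mul_Icc₀ _ _ ha, zero_div, div_self ha.ne']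
  rw [restrict_Ioc_eq_restrict_Icc, ← Measure.restrict_smul, ← abs_of_pos (inv_pos.2 ha),
    ← Real.map_volume_mul_left ha.ne', Measure.restrict_map (by fun_prop) measurableSet_Icc, hpre]

end WeightedPathLaw

section SizeBiasedTemperedStable

variable {Ω : Type*} [MeasurableSpace Ω] {P : Measure Ω} [IsProbabilityMeasure P]
  {α : ℝ} {ψ : ℝ≥0 → Ω → ℝ≥0} {a : ℝ≥0}

lemma lintegral_coordinate_temperedLevyMeasure (hα : α ∈ Ioo 0 1) (a : ℝ≥0) :
    ∫⁻ y, (y a : ℝ≥0∞) ∂(temperedLevyMeasure α (Ioi 0)) = .ofReal (α * a) := by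
  have := isProbabilityMeasure_gammaMeasure (sub_pos.2 hα.2) one_pos
  have : IsProbabilityMeasure ((gammaMeasure (1 - α) 1).map Real.toNNReal) :=
    Measure.isProbabilityMeasure_map measurable_real_toNNReal.aemeasurable
  rw [← setLIntegral_univ, ← withDensity_apply _ .univ,
    withDensity_coordinate_temperedLevyMeasure hα, Measure.smul_apply, stepPathMeasure,
    Measure.map_apply measurable_stepPath .univ]
  simp [← univ_prod_univ, Measure.prod_prod, ENNReal.ofReal_mul hα.1.le]

theorem IsTemperedStableSubordinator.lintegral_eq (hψ : IsTemperedStableSubordinator P α ψ)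
    (hα : α ∈ Ioo 0 1) (a : ℝ≥0) : ∫⁻ ω, ψ a ω ∂P = .ofReal (α * a) := by
  have := hψ.isProbabilityMeasure_pathLaw
  have hmean := lintegral_coordinate_temperedLevyMeasure hα a
  rw [← hmean, ← (hψ.isLevyMeasure hα).lintegral_coordinate (by simp [hmean]), pathLaw,
    lintegral_map (by fun_prop) hψ.measurable_path]

lemma pathLaw_stepPath_gamma_uniform (hα : α ∈ Ioo 0 1) (ha : 0 < a) {G U : Ω → ℝ≥0}
    (hG : HasLaw (fun ω => (G ω : ℝ)) (gammaMeasure (1 - α) 1) P)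
    (hU : HasLaw (fun ω => (U ω : ℝ)) (volume.restrict (Icc 0 1)) P) (hGU : IndepFun G U P) :
    pathLaw P (fun t ω => stepPath (G ω) (a * U ω) t) = (ENNReal.ofReal (α * a))⁻¹ •
      (temperedLevyMeasure α (Ioi 0)).withDensity (fun y => (y a : ℝ≥0∞)) := by
  have := isProbabilityMeasure_gammaMeasure (sub_pos.2 hα.2) one_pos
  have hind : IndepFun (fun ω => (U ω : ℝ)) G P :=
    hGU.symm.comp measurable_coe_nnreal_real measurable_id
  have hlaw := pathLaw_withDensity_stepPath hU (hasLaw_of_coe hG) hind (T := ((a : ℝ) * ·))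
    (by fun_prop) measurable_one measurable_one
  have hmass : ENNReal.ofReal (a : ℝ)⁻¹ = (.ofReal (α * a))⁻¹ * .ofReal α := by
    have hα0 := hα.1
    rw [← ENNReal.ofReal_inv_of_pos (by positivity), ← ENNReal.ofReal_mul (by positivity)]
    congr 1
    field_simp
  simp only [Pi.one_apply, mul_one, withDensity_one, ← Pi.one_def, ← NNReal.coe_mul,
    Real.toNNReal_coe] at hlaw
  rw [hlaw, map_mul_left_restrict_Icc (NNReal.coe_pos.2 ha),
    withDensity_coordinate_temperedLevyMeasure hα, smul_smul, ← hmass, stepPathMeasure,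
    Measure.prod_smul_left, Measure.map_smul, stepPathMeasure]

theorem IsTemperedStableSubordinator.pathLaw_add_stepPath
    (hψ : IsTemperedStableSubordinator P α ψ) (hα : α ∈ Ioo 0 1) (ha : 0 < a) {G U : Ω → ℝ≥0}
    (hG : HasLaw (fun ω => (G ω : ℝ)) (gammaMeasure (1 - α) 1) P)
    (hU : HasLaw (fun ω => (U ω : ℝ)) (volume.restrict (Icc 0 1)) P) (hGU : IndepFun G U P)
    (hind : IndepFun (fun ω => (G ω, U ω)) (fun ω t => ψ t ω) P) :
    pathLaw P (fun t ω => ψ t ω + stepPath (G ω) (a * U ω) t) =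
      pathLaw (P.withDensity fun ω => .ofReal (ψ a ω / (α * a))) ψ := by
  have hmean := lintegral_coordinate_temperedLevyMeasure hα a
  have hfin : ∫⁻ y, (y a : ℝ≥0∞) ∂(temperedLevyMeasure α (Ioi 0)) ≠ ∞ := by simp [hmean]
  have := isFiniteMeasure_withDensity hfin
  have := hψ.isProbabilityMeasure_pathLaw
  have hmeas : Measurable fun p : ℝ≥0 × ℝ≥0 => stepPath p.1 (a * p.2) := by
    simpa only [Function.comp_def, Real.toNNReal_coe] using measurable_stepPath.comp
      (by fun_prop : Measurable fun p : ℝ≥0 × ℝ≥0 => (((a * p.2 : ℝ≥0) : ℝ), p.1))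
  have hstep : AEMeasurable (fun ω => stepPath (G ω) (a * U ω)) P :=
    hmeas.comp_aemeasurable ((hasLaw_of_coe hG).aemeasurable.prodMk (hasLaw_of_coe hU).aemeasurable)
  rw [pathLaw_add hψ.measurable_path.aemeasurable hstep (hind.symm.comp measurable_id hmeas),
    pathLaw_stepPath_gamma_uniform hα ha hG hU hGU, Measure.prod_smul_right, Measure.map_smul,
    ← (hψ.isLevyMeasure hα).withDensity_coordinate hfin, pathLaw_withDensity_div
      hψ.measurable_path.aemeasurable a (mul_pos hα.1 (NNReal.coe_pos.2 ha))]

end SizeBiasedTemperedStable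

section LevyMeasureRepresentation

lemma lintegral_lintegral_Ioc (ρ : Measure ℝ) [SFinite ρ] {g : ℝ → ℝ≥0∞} (hg : Measurable g) :
    ∫⁻ y, (∫⁻ s in Ioc 0 y, g s) ∂ρ = ∫⁻ s in Ioi 0, g s * ρ (Ici s) := by
  have hmeas : Measurable fun p : ℝ × ℝ => (Iic p.1).indicator g p.2 :=
    (hg.comp measurable_snd).indicator (measurableSet_le measurable_snd measurable_fst)
  have hindicator (y s : ℝ) : (Iic y).indicator g s = (Ici s).indicator (fun _ => g s) y := by
    simp [indicator_apply]
  simp only [← Ioi_inter_Iic, inter_comm (Ioi _), ← setLIntegral_indicator measurableSet_Iic]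
  rw [lintegral_lintegral_swap hmeas.aemeasurable]
  simp only [hindicator, lintegral_indicator measurableSet_Ici, setLIntegral_const]

lemma expMeasure_one_Ici {s : ℝ} (hs : 0 ≤ s) :
    expMeasure 1 (Ici s) = .ofReal (Real.exp (-s)) := by
  rw [expMeasure, gammaMeasure, withDensity_apply _ measurableSet_Ici,
    setLIntegral_congr_fun (g := fun y => .ofReal (Real.exp (-y))) measurableSet_Ici fun y hy => ?_,
    ← setLIntegral_congr Ioi_ae_eq_Ici, ← integral_exp_neg_Ioi s,
    ofReal_integral_eq_lintegral_ofReal (integrableOn_exp_neg_Ioi s)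
      (ae_of_all _ fun y => by positivity)]
  exact (exponentialPDF_of_nonneg (hs.trans hy)).trans (by simp only [one_mul])

-- Given `Y = y`, the product `yU` has density `y⁻¹` on `(0, y]`, so weighting by `y e ^ (yU)`
-- leaves `e ^ s ds` there, and `P(Y ≥ s) = e ^ (-s)` cancels the exponential.
theorem map_mul_withDensity_expMeasure_prod :
    (((expMeasure 1).prod (volume.restrict (Icc (0 : ℝ) 1))).withDensity
      fun p => .ofReal (p.1 * Real.exp (p.1 * p.2))).map (fun p => p.1 * p.2) =
      volume.restrict (Ioi 0) := by
  have := isProbabilityMeasure_expMeasure one_pos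
  refine Measure.ext_of_lintegral _ fun h hh => ?_
  have hconditional {y : ℝ} (hy : 0 < y) :
      ∫⁻ u in Icc 0 1, .ofReal (y * Real.exp (y * u)) * h (y * u) =
        ∫⁻ s in Ioc 0 y, .ofReal (Real.exp s) * h s := by
    rw [← lintegral_map (f := fun s => .ofReal (y * Real.exp s) * h s) (by fun_prop)
      (measurable_const_mul y), map_mul_left_restrict_Icc hy, lintegral_smul_measure, smul_eq_mul,
      ← lintegral_const_mul _ (by fun_prop)]
    refine lintegral_congr fun s => ?_
    rw [← mul_assoc, ← ENNReal.ofReal_mul (by positivity), inv_mul_cancel_left₀ hy.ne']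
  have hpos : ∀ᵐ y ∂(expMeasure 1), 0 < y := ae_gammaMeasure_pos 1 1
  calc ∫⁻ s, h s ∂(((expMeasure 1).prod (volume.restrict (Icc (0 : ℝ) 1))).withDensity
        fun p => .ofReal (p.1 * Real.exp (p.1 * p.2))).map (fun p => p.1 * p.2)
      = ∫⁻ y, (∫⁻ u in Icc 0 1, .ofReal (y * Real.exp (y * u)) * h (y * u)) ∂(expMeasure 1) := by
        rw [lintegral_map hh (by fun_prop),
          lintegral_withDensity_eq_lintegral_mul _ (by fun_prop) (by fun_prop),
          lintegral_prod _ (by fun_prop)]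
        rfl
    _ = ∫⁻ y, (∫⁻ s in Ioc 0 y, .ofReal (Real.exp s) * h s) ∂(expMeasure 1) := by
        refine lintegral_congr_ae ?_
        filter_upwards [hpos] with y hy using hconditional hy
    _ = ∫⁻ s in Ioi 0, .ofReal (Real.exp s) * h s * expMeasure 1 (Ici s) :=
        lintegral_lintegral_Ioc _ (by fun_prop)
    _ = ∫⁻ s in Ioi 0, h s := by
        refine setLIntegral_congr_fun measurableSet_Ioi fun s (hs : 0 < s) => ?_
        rw [expMeasure_one_Ici hs.le, mul_right_comm, ← ENNReal.ofReal_mul (by positivity),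
          ← Real.exp_add, add_neg_cancel, Real.exp_zero, ENNReal.ofReal_one, one_mul]

variable {α : ℝ}

lemma temperedJumpMeasure_eq_withDensity_inv (hα : α ∈ Ioo 0 1) :
    temperedJumpMeasure α = ((gammaMeasure (1 - α) 1).map Real.toNNReal).withDensity
      fun x => .ofReal α * (x⁻¹ : ℝ≥0) := by
  have hone : (fun x : ℝ≥0 => (x : ℝ≥0∞) * (x⁻¹ : ℝ≥0)) =ᵐ[temperedJumpMeasure α] 1 := by
    filter_upwards [compl_mem_ae_iff.2 (temperedJumpMeasure_singleton_zero α)] with x hx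
    rw [← ENNReal.coe_mul, mul_inv_cancel₀ hx, ENNReal.coe_one, Pi.one_apply]
  calc temperedJumpMeasure α
      = (temperedJumpMeasure α).withDensity fun x : ℝ≥0 => (x : ℝ≥0∞) * (x⁻¹ : ℝ≥0) := by
        rw [withDensity_congr_ae hone, withDensity_one]
    _ = ((temperedJumpMeasure α).withDensity (↑)).withDensity fun x => (x⁻¹ : ℝ≥0) :=
        withDensity_mul _ (by fun_prop) (by fun_prop)
    _ = _ := by
        rw [withDensity_coe_temperedJumpMeasure hα, withDensity_smul_measure,
          ← withDensity_smul _ (by fun_prop)]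
        rfl

theorem temperedLevyMeasure_eq_pathLaw {Ω : Type*} [MeasurableSpace Ω] {P : Measure Ω}
    [IsProbabilityMeasure P] (hα : α ∈ Ioo 0 1) {G U Y : Ω → ℝ≥0}
    (hG : HasLaw (fun ω => (G ω : ℝ)) (gammaMeasure (1 - α) 1) P)
    (hU : HasLaw (fun ω => (U ω : ℝ)) (volume.restrict (Icc 0 1)) P)
    (hY : HasLaw (fun ω => (Y ω : ℝ)) (expMeasure 1) P) (hind : iIndepFun ![G, U, Y] P) :
    temperedLevyMeasure α (Ioi 0) = pathLaw
      (P.withDensity fun ω => .ofReal (α * (G ω : ℝ)⁻¹ * Y ω * Real.exp (U ω * Y ω)))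
      (fun t ω => stepPath (G ω) (U ω * Y ω) t) := by
  have := isProbabilityMeasure_gammaMeasure (sub_pos.2 hα.2) one_pos
  have haemeas (i : Fin 3) : AEMeasurable (![G, U, Y] i) P := by
    fin_cases i
    exacts [(hasLaw_of_coe hG).aemeasurable, (hasLaw_of_coe hU).aemeasurable,
      (hasLaw_of_coe hY).aemeasurable]
  have hYU : IndepFun (fun ω => (Y ω : ℝ)) (fun ω => (U ω : ℝ)) P :=
    (hind.indepFun (i := 2) (j := 1) (by decide)).comp measurable_coe_nnreal_real
      measurable_coe_nnreal_real
  have hYU_G : IndepFun (fun ω => ((Y ω : ℝ), (U ω : ℝ))) G P :=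
    (hind.indepFun_prodMk₀ haemeas 2 1 0 (by decide) (by decide)).comp
      (φ := fun p : ℝ≥0 × ℝ≥0 => ((p.1 : ℝ), (p.2 : ℝ))) (by fun_prop) measurable_id
  have hlaw := pathLaw_withDensity_stepPath ((indepFun_iff_hasLaw_prodMk_prod hY hU).1 hYU)
    (hasLaw_of_coe hG) hYU_G (T := fun p => p.1 * p.2) (by fun_prop)
    (f := fun p => .ofReal (p.1 * Real.exp (p.1 * p.2))) (by fun_prop)
    (g := fun x => ENNReal.ofReal α * (x⁻¹ : ℝ≥0)) (by fun_prop)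
  have hweight (x y z : ℝ≥0) : ENNReal.ofReal (α * (x : ℝ)⁻¹ * y * Real.exp (z * y)) =
      .ofReal (y * Real.exp (y * z)) * (.ofReal α * (x⁻¹ : ℝ≥0)) := by
    rw [← ENNReal.ofReal_coe_nnreal, ← ENNReal.ofReal_mul hα.1.le,
      ← ENNReal.ofReal_mul (by positivity), NNReal.coe_inv, mul_comm (z : ℝ)]
    ring_nf
  rw [map_mul_withDensity_expMeasure_prod, ← temperedJumpMeasure_eq_withDensity_inv hα] at hlaw
  rw [temperedLevyMeasure, ← hlaw]
  simp only [hweight]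
  simp only [← NNReal.coe_mul, Real.toNNReal_coe, mul_comm (U _)]

theorem lintegral_temperedLevyMeasure_eq {Ω : Type*} [MeasurableSpace Ω] {P : Measure Ω}
    [IsProbabilityMeasure P] (hα : α ∈ Ioo 0 1) {G U Y : Ω → ℝ≥0}
    (hG : HasLaw (fun ω => (G ω : ℝ)) (gammaMeasure (1 - α) 1) P)
    (hU : HasLaw (fun ω => (U ω : ℝ)) (volume.restrict (Icc 0 1)) P)
    (hY : HasLaw (fun ω => (Y ω : ℝ)) (expMeasure 1) P) (hind : iIndepFun ![G, U, Y] P)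
    {F : TimePath → ℝ≥0∞} (hF : Measurable F) :
    ∫⁻ y, F y ∂(temperedLevyMeasure α (Ioi 0)) = .ofReal α *
      ∫⁻ ω, .ofReal ((G ω : ℝ)⁻¹ * Y ω * Real.exp (U ω * Y ω)) *
        F (stepPath (G ω) (U ω * Y ω)) ∂P := by
  have hG' := (hasLaw_of_coe hG).aemeasurable
  have hU' := (hasLaw_of_coe hU).aemeasurable
  have hY' := (hasLaw_of_coe hY).aemeasurable
  have hstep : AEMeasurable (fun ω => stepPath (G ω) (U ω * Y ω)) P := by
    simpa only [Real.toNNReal_coe] using measurable_stepPath.comp_aemeasurable'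
      (by fun_prop : AEMeasurable (fun ω => (((U ω * Y ω : ℝ≥0) : ℝ), G ω)) P)
  rw [temperedLevyMeasure_eq_pathLaw hα hG hU hY hind,
    lintegral_pathLaw_withDensity hstep (by fun_prop) hF, ← lintegral_const_mul' _ _ (by simp)]
  simp only [mul_assoc α, ENNReal.ofReal_mul hα.1.le, mul_assoc (ENNReal.ofReal α)]

end LevyMeasureRepresentation

theorem mainTheorem7 {Ω Ω' : Type*} [MeasurableSpace Ω] [MeasurableSpace Ω']
    (P : Measure Ω) [IsProbabilityMeasure P] (P' : Measure Ω') [IsProbabilityMeasure P']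
    (α : ℝ) (hα : α ∈ Ioo (0 : ℝ) 1)
    (ψ : ℝ≥0 → Ω → ℝ≥0) (hψ : IsTemperedStableSubordinator P α ψ) :
    -- (a4)
    (∀ (a : ℝ≥0), 0 < a → ∫⁻ ω, ψ a ω ∂P = ENNReal.ofReal (α * a) ∧
      ∀ (G U : Ω → ℝ≥0),
      HasLaw (fun ω => (G ω : ℝ)) (gammaMeasure (1 - α) 1) P →
      HasLaw (fun ω => (U ω : ℝ)) (volume.restrict (Icc 0 1)) P →
      IndepFun G U P →
      IndepFun (fun ω => (G ω, U ω)) (fun ω t => ψ t ω) P →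
      pathLaw P (fun t ω => ψ t ω + stepPath (G ω) (a * U ω) t) =
        pathLaw (P.withDensity fun ω => ENNReal.ofReal (ψ a ω / (α * a))) ψ) ∧
    -- (b4)
    (∃! ν, IsLevyMeasure (pathLaw P ψ) ν) ∧
    (∀ (G U Y : Ω' → ℝ≥0),
      HasLaw (fun ω => (G ω : ℝ)) (gammaMeasure (1 - α) 1) P' →
      HasLaw (fun ω => (U ω : ℝ)) (volume.restrict (Icc 0 1)) P' →
      HasLaw (fun ω => (Y ω : ℝ)) (expMeasure 1) P' →
      iIndepFun ![G, U, Y] P' →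
      ∀ ν, IsLevyMeasure (pathLaw P ψ) ν →
        (∀ F : TimePath → ℝ≥0∞, Measurable F →
          ∫⁻ y, F y ∂ν = ENNReal.ofReal α *
            ∫⁻ ω, ENNReal.ofReal ((G ω : ℝ)⁻¹ * Y ω * Real.exp (U ω * Y ω)) *
              F (stepPath (G ω) (U ω * Y ω)) ∂P') ∧
        ν = pathLaw
          (P'.withDensity fun ω =>
            ENNReal.ofReal (α * (G ω : ℝ)⁻¹ * Y ω * Real.exp (U ω * Y ω)))
          (fun t ω => stepPath (G ω) (U ω * Y ω) t)) ∧
    -- (c4)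
    (∀ (a : ℝ≥0), 0 < a →
      (∀ κ, IsCondLawAtZero (pathLaw P ψ) a κ ↔
        κ = pathLaw P (fun t ω => ψ (max t a) ω - ψ a ω)) ∧
      (∀ η, IsComplementLaw (pathLaw P ψ) a η ↔
        η = pathLaw P (fun t ω => ψ (min t a) ω)) ∧
      (∀ κ, IsCondLawAtZero (pathLaw P ψ) a κ →
        (∃! ν, IsLevyMeasure κ ν) ∧
        ∀ ν, IsLevyMeasure κ ν → ∀ F : TimePath → ℝ≥0∞, Measurable F →
          ∫⁻ y, F y ∂ν = temperedJumpIntegral α (Ioi (a : ℝ)) F) ∧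
      (∀ η, IsComplementLaw (pathLaw P ψ) a η →
        (∃! ν, IsLevyMeasure η ν) ∧
        ∀ ν, IsLevyMeasure η ν → ∀ F : TimePath → ℝ≥0∞, Measurable F →
          ∫⁻ y, F y ∂ν = temperedJumpIntegral α (Ioc 0 (a : ℝ)) F)) := by
  have hpos (a ε : ℝ≥0) (hε : 0 < ε) : P {ω | ψ a ω ≤ ε} ≠ 0 :=
    hψ.measure_le_ne_zero (hψ.tendsto_laplaceExponent_div hα) hε
  refine ⟨fun a ha => ⟨hψ.lintegral_eq hα a, fun G U => hψ.pathLaw_add_stepPath hα ha⟩,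
    (hψ.isLevyMeasure hα).existsUnique, fun G U Y hG hU hY hind ν hν => ?_, fun a _ =>
    ⟨hψ.isCondLawAtZero_iff (hpos a), hψ.isComplementLaw_iff (hpos a), fun κ hκ => ?_,
      fun η hη => ?_⟩⟩
  · rw [hν.unique (hψ.isLevyMeasure hα)]
    exact ⟨fun F hF => lintegral_temperedLevyMeasure_eq hα hG hU hY hind hF,
      temperedLevyMeasure_eq_pathLaw hα hG hU hY hind⟩
  · rw [hψ.isCondLawAtZero_iff (hpos a)] at hκ
    subst hκ
    have hfuture := hψ.isLevyMeasure_future hα a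
    exact ⟨hfuture.existsUnique, fun ν hν F hF =>
      hν.unique hfuture ▸ lintegral_temperedLevyMeasure α _ hF⟩
  · rw [hψ.isComplementLaw_iff (hpos a)] at hη
    subst hη
    have hpast := hψ.isLevyMeasure_past hα a
    exact ⟨hpast.existsUnique, fun ν hν F hF =>
      hν.unique hpast ▸ lintegral_temperedLevyMeasure α _ hF⟩
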